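/- Let $\mathcal D\subset\mathbb R^3$ be open and bounded with Lipschitz boundary, and let the exterior domain $\mathbb R^3\setminus\overline{\mathcal D}$ be connected. Let $\tau\in(0,\infty)$, $\varrho\in\mathbb R\setminus\{0\}$, $e_1=(1,0,0)$, and let $R\in(0,\infty)$ satisfy $\overline{\mathcal D}\subset B_R:=\{x\in\mathbb R^3:|x|<R\}$. Put $\mathcal D_R:=B_R\setminus\overline{\mathcal D}$. For $u,w\in H^1(\mathcal D_R)^3$, with boundary values on $\partial B_R$ in the sense of traces, define $$a_R(u,w):=\int_{\mathcal D_R}\bigl[\nabla u\cdot\nabla w+\tau\,\partial_1u\cdot w\bigr]\,dx+\frac{\tau}{2}\int_{\partial B_R}(u(x)\cdot w(x))\Bigl(1-\frac{x_1}{R}\Bigr)\,do_x,$$ $$\delta_R(u,w):=\int_{\mathcal D_R}\bigl[-\bigl((\varrho e_1\times x)\cdot\nabla\bigr)u(x)+\varrho e_1\times u(x)\bigr]\cdot w(x)\,dx,$$ $$|u|^{(R)}:=\Bigl(\|\nabla u\|_{L^2(\mathcal D_R)}^2+\frac{\tau}{2}\,\|u|_{\partial B_R}\|_{L^2(\partial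 B_R)}^2\Bigr)^{1/2}.$$ Then there is a constant $C>0$, which may depend on $R,\mathcal D,\tau,\varrho$ but not on $u$ and $w$, such that $$|a_R(u,w)+\delta_R(u,w)|\le C\,|u|^{(R)}\,|w|^{(R)}\qquad\text{for all }u,w\in H^1(\mathcal D_R)^3.$$ -/

import Mathlib

open MeasureTheory Filter Topology
open scoped ContDiff NNReal ENNReal Matrix

namespace TruncatedFlow

/-- Three-dimensional Euclidean space. -/
abbrev E3 : Type := EuclideanSpace ℝ (Fin 3)

/-- The boundary of `D` is Lipschitz: near each boundary point and after an orthogonal change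
of coordinates, `D` is the region strictly above the graph of a Lipschitz function. -/
def HasLipschitzBoundary (D : Set E3) : Prop :=
  ∀ p ∈ frontier D, ∃ (A : E3 ≃ₗᵢ[ℝ] E3) (K : ℝ≥0) (φ : EuclideanSpace ℝ (Fin 2) → ℝ) (r : ℝ),
    0 < r ∧ LipschitzWith K φ ∧
      ∀ x ∈ Metric.ball p r, (x ∈ D ↔ φ (!₂[A x 0, A x 1]) < A x 2)

/-- The truncation `D_R = B_R \ closure D` of the exterior domain. -/
def truncation (D : Set E3) (R : ℝ) : Set E3 := Metric.ball 0 R \ closure D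

/-- `g` is the weak `j`-th partial derivative of `u` on the open set `U`. It is only used for
`u` and `g` square integrable over `U`, so that both integrals converge. -/
def HasWeakPartial (U : Set E3) (j : Fin 3) (u g : E3 → E3) : Prop :=
  ∀ φ : E3 → ℝ, ContDiff ℝ ∞ φ → HasCompactSupport φ → tsupport φ ⊆ U →
    ∫ x in U, (fderiv ℝ φ x (EuclideanSpace.single j 1)) • u x = - ∫ x in U, φ x • g x

/-- Membership in `H¹(U)³`. -/
def MemH1 (U : Set E3) (u : E3 → E3) : Prop :=
  MemLp u 2 (volume.restrict U) ∧
    ∀ j, ∃ g : E3 → E3, MemLp g 2 (volume.restrict U) ∧ HasWeakPartial U j u g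

open Classical in
/-- The weak derivative `∂_j u` on `U` of a function `u ∈ H¹(U)³` (unique a.e. on `U`). -/
noncomputable def weakPartial (U : Set E3) (j : Fin 3) (u : E3 → E3) : E3 → E3 :=
  if h : ∃ g : E3 → E3, MemLp g 2 (volume.restrict U) ∧ HasWeakPartial U j u g
  then h.choose else 0

/-- Convergence `v k → u` in `H¹(U)³`. -/
def TendstoH1 (U : Set E3) (v : ℕ → E3 → E3) (u : E3 → E3) : Prop :=
  Tendsto (fun k => eLpNorm (v k - u) 2 (volume.restrict U)) atTop (𝓝 0) ∧
    ∀ j, Tendsto (fun k => eLpNorm (weakPartial U j (v k) - weakPartial U j u) 2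
      (volume.restrict U)) atTop (𝓝 0)

/-- The surface measure `do_x` of the sphere `∂B_R`, as a measure on the whole space: the image
of the surface measure of the unit sphere under `θ ↦ R θ`, multiplied by `R ^ 2`. -/
noncomputable def surfaceMeasure (R : ℝ) : Measure E3 :=
  ENNReal.ofReal (R ^ 2) •
    Measure.map (fun θ : Metric.sphere (0 : E3) 1 => R • (θ : E3)) (volume : Measure E3).toSphere

/-- `T ∈ L²(∂B_R)³` is the trace on `∂B_R` of `u ∈ H¹(D_R)³`: it is the `L²(∂B_R)`-limit of the
boundary values of functions in `H¹(D_R)³` that are continuous up to `∂B_R` (that is, on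
`{x : r < |x| ≤ R}` for some `r < R`) and converge to `u` in `H¹(D_R)³`. -/
def IsTrace (D : Set E3) (R : ℝ) (u T : E3 → E3) : Prop :=
  MemLp T 2 (surfaceMeasure R) ∧
    ∃ v : ℕ → E3 → E3,
      (∀ k, MemH1 (truncation D R) (v k) ∧
        ∃ r < R, ContinuousOn (v k) (Metric.closedBall 0 R \ Metric.closedBall 0 r)) ∧
      TendstoH1 (truncation D R) v u ∧
      Tendsto (fun k => eLpNorm (v k - T) 2 (surfaceMeasure R)) atTop (𝓝 0)

open Classical in
/-- The trace `u|∂B_R` of `u ∈ H¹(D_R)³` (unique a.e. on `∂B_R`). -/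
noncomputable def trace (D : Set E3) (R : ℝ) (u : E3 → E3) : E3 → E3 :=
  if h : ∃ T, IsTrace D R u T then h.choose else 0

/-- The vector `e₁ × x`, where `e₁ = (1, 0, 0)`. -/
noncomputable def e1Cross (x : E3) : E3 :=
  WithLp.toLp 2 (crossProduct ![(1 : ℝ), 0, 0] (WithLp.ofLp x))

/-- `|u|^{(R)} = (‖∇u‖₂² + (τ/2) ‖u|∂B_R‖₂²)^{1/2}`. -/
noncomputable def normR (D : Set E3) (τ R : ℝ) (u : E3 → E3) : ℝ :=
  Real.sqrt ((∫ x in truncation D R, ∑ j : Fin 3, ‖weakPartial (truncation D R) j u x‖ ^ 2) +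
    τ / 2 * ∫ x, ‖trace D R u x‖ ^ 2 ∂(surfaceMeasure R))

/-- The bilinear form `a_R`. -/
noncomputable def aForm (D : Set E3) (τ R : ℝ) (u w : E3 → E3) : ℝ :=
  (∫ x in truncation D R,
    ((∑ j : Fin 3, inner ℝ (weakPartial (truncation D R) j u x)
        (weakPartial (truncation D R) j w x)) +
      τ * inner ℝ (weakPartial (truncation D R) 0 u x) (w x))) +
  τ / 2 * ∫ x, inner ℝ (trace D R u x) (trace D R w x) * (1 - x 0 / R) ∂(surfaceMeasure R)

/-- The bilinear form `δ_R`. -/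
noncomputable def deltaForm (D : Set E3) (ρ R : ℝ) (u w : E3 → E3) : ℝ :=
  ∫ x in truncation D R,
    inner ℝ
      (-(∑ j : Fin 3, (ρ • e1Cross x) j • weakPartial (truncation D R) j u x) +
        ρ • e1Cross (u x))
      (w x)

end TruncatedFlow

namespace TruncatedFlow

/-! By Cauchy–Schwarz, every interior term of the two forms is at most a constant times the product
of the `H¹` norms of `u` and `w`, because the rotational coefficient has size at most `|ρ| * R` on
the ball. The boundary term is controlled by the traces, since `|1 - x₁/R| ≤ 2` on the sphere. What
remains is a Poincaré inequality in which the gradient and the trace on the outer sphere bound the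
full `L²` norm (`exists_poincare`).

The inequality is proved by a direct argument that does not use compact embeddings. Its engine is
`ae_sub_eq_integral_flow`: a weakly differentiable function satisfies the fundamental theorem of
calculus along the segments `x + t • (c + m • x)`, for almost every `x`. Dilations (`c = 0`, `m =
1`) compare values in a shell with values on the sphere; this gives the `L²` bound in the shell and
also a trace inequality (`exists_shell_and_trace_bound`). Translations (`m = 0`) carry a local `L²`
bound from one point to another, at the cost of the gradient (`LocalBound.of_shift`). Connectedness
of the exterior spreads the bound from the shell to every point outside `closure D`, a push along
the graph direction of a Lipschitz chart reaches the boundary of `D`, and compactness of the closure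
of the domain makes the constant global.

The trace is defined as a limit, so its existence needs approximation in `H¹` by functions
continuous up to the sphere. These come from a mollification combined with a contraction towards the
origin (`dilAvg`, `exists_approximation`); the trace inequality then gives convergence on the sphere
(`exists_isTrace`). -/

/-! ### Calculus of weak partial derivatives. -/

theorem integrable_test_smul {F : Type*} [NormedAddCommGroup F] [NormedSpace ℝ F]
    {μ : Measure E3} {f : E3 → F} (hf : Integrable f μ)
    {ψ : E3 → ℝ} (hc : Continuous ψ) (hs : HasCompactSupport ψ) :
    Integrable (fun x => ψ x • f x) μ := by
  obtain ⟨C, hC⟩ := hs.exists_bound_of_continuous hc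
  exact hf.bdd_smul C hc.aestronglyMeasurable (Eventually.of_forall hC)

theorem continuous_partial {φ : E3 → ℝ} (hφ : ContDiff ℝ ∞ φ) (e : E3) :
    Continuous fun x => fderiv ℝ φ x e :=
  (hφ.continuous_fderiv (by simp)).clm_apply continuous_const

theorem hasCompactSupport_partial {φ : E3 → ℝ} (hs : HasCompactSupport φ) (e : E3) :
    HasCompactSupport fun x => fderiv ℝ φ x e :=
  (hs.fderiv ℝ).comp_left (g := fun L : E3 →L[ℝ] ℝ => L e) (by simp)

theorem integrable_partial_smul {μ : Measure E3} {f : E3 → E3} (hf : Integrable f μ)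
    {φ : E3 → ℝ} (hφ : ContDiff ℝ ∞ φ) (hs : HasCompactSupport φ) (e : E3) :
    Integrable (fun x => fderiv ℝ φ x e • f x) μ :=
  integrable_test_smul hf (continuous_partial hφ e) (hasCompactSupport_partial hs e)

theorem setIntegral_smul_eq_integral {U : Set E3} {ψ : E3 → ℝ} (hψ : tsupport ψ ⊆ U)
    (f : E3 → E3) : ∫ x in U, ψ x • f x = ∫ x, ψ x • f x :=
  setIntegral_eq_integral_of_forall_compl_eq_zero fun x hx => by
    rw [image_eq_zero_of_notMem_tsupport fun h => hx (hψ h), zero_smul]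

theorem setIntegral_smul_eq_indicator {U : Set E3} (hU : MeasurableSet U) (ψ : E3 → ℝ)
    (f : E3 → E3) : ∫ x in U, ψ x • f x = ∫ x, ψ x • U.indicator f x := by
  rw [← integral_indicator hU]
  refine integral_congr_ae (Eventually.of_forall fun x => ?_)
  by_cases hx : x ∈ U <;> simp [hx]

theorem HasWeakPartial.congr {U : Set E3} {j : Fin 3} {u v g : E3 → E3}
    (h : HasWeakPartial U j u g) (huv : u =ᵐ[volume.restrict U] v) : HasWeakPartial U j v g := by
  intro φ h1 h2 h3
  rw [← h φ h1 h2 h3]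
  refine integral_congr_ae ?_
  filter_upwards [huv] with x hx
  rw [hx]

theorem HasWeakPartial.mono {U V : Set E3} {j : Fin 3} {u g : E3 → E3}
    (h : HasWeakPartial U j u g) (hVU : V ⊆ U) : HasWeakPartial V j u g := by
  intro φ h1 h2 h3
  have h4 : tsupport (fun x => fderiv ℝ φ x (EuclideanSpace.single j 1)) ⊆ tsupport φ :=
    (tsupport_fderiv_apply_subset ℝ _)
  have := h φ h1 h2 (h3.trans hVU)
  rwa [setIntegral_smul_eq_integral (h4.trans (h3.trans hVU)),
    setIntegral_smul_eq_integral (h3.trans hVU), ← setIntegral_smul_eq_integral (h4.trans h3),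
    ← setIntegral_smul_eq_integral h3] at this

theorem HasWeakPartial.sub {U : Set E3} {j : Fin 3} {u v g k : E3 → E3}
    (hu : IntegrableOn u U) (hv : IntegrableOn v U) (hg : IntegrableOn g U)
    (hk : IntegrableOn k U) (h : HasWeakPartial U j u g) (h' : HasWeakPartial U j v k) :
    HasWeakPartial U j (u - v) (g - k) := by
  intro φ h1 h2 h3
  simp only [Pi.sub_apply, smul_sub]
  rw [integral_sub (integrable_partial_smul hu h1 h2 _) (integrable_partial_smul hv h1 h2 _),
    integral_sub (integrable_test_smul hg h1.continuous h2)
      (integrable_test_smul hk h1.continuous h2), h φ h1 h2 h3, h' φ h1 h2 h3]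
  abel

/-- Fundamental lemma of the calculus of variations applied to `g - k`. It makes the arbitrary
choice in `weakPartial` harmless. -/
theorem HasWeakPartial.ae_eq {U : Set E3} (hU : IsOpen U) {j : Fin 3} {u g k : E3 → E3}
    (hg : IntegrableOn g U) (hk : IntegrableOn k U)
    (h : HasWeakPartial U j u g) (h' : HasWeakPartial U j u k) :
    g =ᵐ[volume.restrict U] k := by
  have := hU.ae_eq_zero_of_integral_contDiff_smul_eq_zero (f := g - k) (μ := volume)
    (hg.sub hk).locallyIntegrableOn fun φ h1 h2 h3 => by
      rw [← setIntegral_smul_eq_integral h3]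
      simp only [Pi.sub_apply, smul_sub]
      rw [integral_sub (integrable_test_smul hg h1.continuous h2)
        (integrable_test_smul hk h1.continuous h2), sub_eq_zero]
      have a := h φ h1 h2 h3
      rw [h' φ h1 h2 h3] at a
      exact (neg_injective a).symm
  rw [Filter.EventuallyEq, ae_restrict_iff' hU.measurableSet]
  filter_upwards [this] with x hx hxU
  exact sub_eq_zero.1 (hx hxU)

theorem integrableOn_of_memLp_two {U : Set E3} (hb : Bornology.IsBounded U) {u : E3 → E3}
    (hu : MemLp u 2 (volume.restrict U)) : IntegrableOn u U := by
  have : IsFiniteMeasure (volume.restrict U) :=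
    ⟨by rw [Measure.restrict_apply_univ]; exact hb.measure_lt_top⟩
  exact hu.integrable (by norm_num)

theorem MemH1.memLp_weakPartial {U : Set E3} {u : E3 → E3} (hu : MemH1 U u) (j : Fin 3) :
    MemLp (weakPartial U j u) 2 (volume.restrict U) := by
  rw [weakPartial, dif_pos (hu.2 j)]
  exact (hu.2 j).choose_spec.1

theorem MemH1.hasWeakPartial {U : Set E3} {u : E3 → E3} (hu : MemH1 U u) (j : Fin 3) :
    HasWeakPartial U j u (weakPartial U j u) := by
  rw [weakPartial, dif_pos (hu.2 j)]
  exact (hu.2 j).choose_spec.2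

theorem weakPartial_ae_eq {U : Set E3} (hU : IsOpen U) (hb : Bornology.IsBounded U) {j : Fin 3}
    {u g : E3 → E3} (hg : MemLp g 2 (volume.restrict U)) (h : HasWeakPartial U j u g) :
    weakPartial U j u =ᵐ[volume.restrict U] g := by
  have hex : ∃ g : E3 → E3, MemLp g 2 (volume.restrict U) ∧ HasWeakPartial U j u g := ⟨g, hg, h⟩
  rw [weakPartial, dif_pos hex]
  exact hex.choose_spec.2.ae_eq hU (integrableOn_of_memLp_two hb hex.choose_spec.1)
    (integrableOn_of_memLp_two hb hg) h

theorem MemH1.hasWeakPartial_sub {U : Set E3} (hb : Bornology.IsBounded U)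
    {u v : E3 → E3} (hu : MemH1 U u) (hv : MemH1 U v) (j : Fin 3) :
    HasWeakPartial U j (u - v) (weakPartial U j u - weakPartial U j v) :=
  (hu.hasWeakPartial j).sub (integrableOn_of_memLp_two hb hu.1) (integrableOn_of_memLp_two hb hv.1)
    (integrableOn_of_memLp_two hb (hu.memLp_weakPartial j))
    (integrableOn_of_memLp_two hb (hv.memLp_weakPartial j)) (hv.hasWeakPartial j)

theorem MemH1.sub {U : Set E3} (hb : Bornology.IsBounded U)
    {u v : E3 → E3} (hu : MemH1 U u) (hv : MemH1 U v) : MemH1 U (u - v) :=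
  ⟨hu.1.sub hv.1, fun j => ⟨_, (hu.memLp_weakPartial j).sub (hv.memLp_weakPartial j),
    hu.hasWeakPartial_sub hb hv j⟩⟩

theorem MemH1.weakPartial_sub_ae_eq {U : Set E3} (hU : IsOpen U) (hb : Bornology.IsBounded U)
    {u v : E3 → E3} (hu : MemH1 U u) (hv : MemH1 U v) (j : Fin 3) :
    weakPartial U j (u - v) =ᵐ[volume.restrict U] weakPartial U j u - weakPartial U j v :=
  weakPartial_ae_eq hU hb ((hu.memLp_weakPartial j).sub (hv.memLp_weakPartial j))
    (hu.hasWeakPartial_sub hb hv j)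

/-! Affine changes of variables. -/

theorem integral_comp_affine {F : Type*} [NormedAddCommGroup F] [NormedSpace ℝ F]
    (f : E3 → F) {μ : ℝ} (hμ : 0 < μ) (b : E3) :
    ∫ x, f (μ • x + b) = (μ ^ 3)⁻¹ • ∫ x, f x := by
  have := Measure.integral_comp_smul volume (fun x => f (x + b)) μ
  rw [this, integral_add_right_eq_self, abs_of_pos (by positivity)]
  simp

theorem measurableEmbedding_affine {μ : ℝ} (hμ : 0 < μ) (b : E3) :
    MeasurableEmbedding fun x : E3 => μ • x + b :=
  ((Homeomorph.smulOfNeZero μ hμ.ne').trans (Homeomorph.addRight b)).measurableEmbedding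

theorem map_affine_volume {μ : ℝ} (hμ : 0 < μ) (b : E3) :
    Measure.map (fun x : E3 => μ • x + b) volume = ENNReal.ofReal (μ ^ 3)⁻¹ • volume := by
  have h : (fun x : E3 => μ • x + b) = (fun x => x + b) ∘ fun x => μ • x := rfl
  rw [h, ← Measure.map_map (by fun_prop) (by fun_prop),
    Measure.map_addHaar_smul _ hμ.ne', Measure.map_smul, map_add_right_eq_self,
    abs_of_pos (by positivity)]
  simp

theorem lintegral_comp_affine (f : E3 → ℝ≥0∞) {μ : ℝ} (hμ : 0 < μ) (b : E3) :
    ∫⁻ x, f (μ • x + b) = ENNReal.ofReal (μ ^ 3)⁻¹ * ∫⁻ x, f x := by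
  rw [← (measurableEmbedding_affine hμ b).lintegral_map, map_affine_volume hμ,
    lintegral_smul_measure, smul_eq_mul]

theorem lintegral_comp_affine_le (f : E3 → ℝ≥0∞) {μ : ℝ} (hμ : 1 ≤ μ) (b : E3) :
    ∫⁻ x, f (μ • x + b) ≤ ∫⁻ x, f x := by
  rw [lintegral_comp_affine f (by linarith)]
  refine mul_le_of_le_one_left' (ENNReal.ofReal_le_one.2 (inv_le_one_of_one_le₀ ?_))
  exact one_le_pow₀ hμ

theorem integrable_comp_affine {F : Type*} [NormedAddCommGroup F]
    {f : E3 → F} (hf : Integrable f) {μ : ℝ} (hμ : 0 < μ) (b : E3) :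
    Integrable fun x => f (μ • x + b) := by
  rw [← Function.comp_def f, ← (measurableEmbedding_affine hμ b).integrable_map_iff,
    map_affine_volume hμ]
  exact hf.smul_measure ENNReal.ofReal_ne_top

/-! ### The fundamental theorem of calculus along affine displacements. -/

theorem sum_apply_mul_clm (L : E3 →L[ℝ] ℝ) (x : E3) :
    ∑ j, x j * L (EuclideanSpace.single j 1) = L x := by
  conv_rhs => rw [← (EuclideanSpace.basisFun (Fin 3) ℝ).sum_repr x]
  simp [map_sum]

/-- The inverse of `x ↦ x + t • (c + m • x)`. -/
noncomputable def flowInv (c : E3) (m t : ℝ) (y : E3) : E3 := (1 + t * m)⁻¹ • (y - t • c)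

theorem flowInv_flow (c : E3) {m t : ℝ} (h : 0 < 1 + t * m) (x : E3) :
    flowInv c m t ((1 + t * m) • x + t • c) = x := by
  simp [flowInv, smul_smul, h.ne']

theorem flow_flowInv (c : E3) {m t : ℝ} (h : 0 < 1 + t * m) (y : E3) :
    flowInv c m t y + t • (c + m • flowInv c m t y) = y := by
  have : flowInv c m t y + t • (c + m • flowInv c m t y)
      = (1 + t * m) • flowInv c m t y + t • c := by module
  rw [this, flowInv, smul_smul, mul_inv_cancel₀ h.ne', one_smul, sub_add_cancel]

theorem flow_eq (c : E3) (m t : ℝ) (x : E3) :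
    x + t • (c + m • x) = (1 + t * m) • x + t • c := by module

theorem measurable_flowInv (c : E3) (m : ℝ) :
    Measurable fun p : ℝ × E3 => flowInv c m p.1 p.2 := by
  unfold flowInv
  fun_prop

/-- Continuity equation: the differentiated function is the push-forward of the density `φ` under `x
↦ x + t • (c + m • x)`, whose Jacobian is `(1 + t * m) ^ 3`. The bracket on the right is the
divergence of `φ` times the field, see `sum_fderiv_mul_field`. -/
theorem hasDerivAt_transported {φ : E3 → ℝ} (hφ : ContDiff ℝ ∞ φ) (c : E3) {m t : ℝ}
    (h : 0 < 1 + t * m) (y : E3) :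
    HasDerivAt (fun t => (1 + t * m)⁻¹ ^ 3 * φ (flowInv c m t y))
      (-((1 + t * m)⁻¹ ^ 4 * (fderiv ℝ φ (flowInv c m t y) (c + m • flowInv c m t y)
        + 3 * m * φ (flowInv c m t y)))) t := by
  have h1 : HasDerivAt (fun t : ℝ => (1 + t * m)⁻¹) (-m / (1 + t * m) ^ 2) t :=
    (((hasDerivAt_id t).mul_const m).const_add 1).inv h.ne' |>.congr_deriv (by simp)
  have h2 : HasDerivAt (fun t : ℝ => y - t • c) (-c) t := by
    simpa using ((hasDerivAt_id t).smul_const c).const_sub y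
  have h3 : HasDerivAt (fun t : ℝ => flowInv c m t y)
      (-((1 + t * m)⁻¹ • (c + m • flowInv c m t y))) t := by
    refine (h1.smul h2).congr_deriv ?_
    have : (-m / (1 + t * m) ^ 2) = -((1 + t * m)⁻¹ * m * (1 + t * m)⁻¹) := by
      field_simp
    rw [this, flowInv]
    module
  have h4 := (hφ.differentiable (by simp)).differentiableAt (x := flowInv c m t y)
    |>.hasFDerivAt.comp_hasDerivAt t h3
  have h5 : HasDerivAt (fun t : ℝ => (1 + t * m)⁻¹ ^ 3)
      (3 * (1 + t * m)⁻¹ ^ 2 * (-m / (1 + t * m) ^ 2)) t := by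
    simpa using h1.fun_pow 3
  refine (h5.fun_mul h4).congr_deriv ?_
  simp only [map_neg, map_smul, smul_eq_mul, Function.comp]
  field_simp
  ring

theorem fderiv_transported {χ : E3 → ℝ} (hχ : ContDiff ℝ ∞ χ) (c : E3) (m t : ℝ) (y e : E3) :
    fderiv ℝ (fun z => (1 + t * m)⁻¹ ^ 3 * χ (flowInv c m t z)) y e =
      (1 + t * m)⁻¹ ^ 4 * fderiv ℝ χ (flowInv c m t y) e := by
  have h1 : HasFDerivAt (fun z : E3 => flowInv c m t z)
      ((1 + t * m)⁻¹ • ContinuousLinearMap.id ℝ E3) y :=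
    HasFDerivAt.fun_const_smul ((hasFDerivAt_id y).sub_const _) _
  have h2 := ((hχ.differentiable (by simp)).differentiableAt (x := flowInv c m t y)
    |>.hasFDerivAt.comp y h1).const_mul ((1 + t * m)⁻¹ ^ 3)
  rw [HasFDerivAt.fderiv (f := fun z => (1 + t * m)⁻¹ ^ 3 * χ (flowInv c m t z)) h2]
  simp only [_root_.smul_apply, ContinuousLinearMap.comp_apply,
    ContinuousLinearMap.id_apply, map_smul, smul_eq_mul]
  ring

theorem contDiff_mul_field {φ : E3 → ℝ} (hφ : ContDiff ℝ ∞ φ) (c : E3) (m : ℝ) (j : Fin 3) :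
    ContDiff ℝ ∞ fun x => φ x * (c + m • x) j := by
  have : ContDiff ℝ ∞ fun x : E3 => (c + m • x) j := by
    simp only [PiLp.add_apply, PiLp.smul_apply]
    fun_prop
  exact hφ.mul this

theorem sum_fderiv_mul_field {φ : E3 → ℝ} (hφ : ContDiff ℝ ∞ φ) (c : E3) (m : ℝ) (x : E3) :
    ∑ j, fderiv ℝ (fun x => φ x * (c + m • x) j) x (EuclideanSpace.single j 1) =
      fderiv ℝ φ x (c + m • x) + 3 * m * φ x := by
  have key : ∀ j, fderiv ℝ (fun x => φ x * (c + m • x) j) x (EuclideanSpace.single j 1) =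
      φ x * m + (c + m • x) j * fderiv ℝ φ x (EuclideanSpace.single j 1) := by
    intro j
    have h1 : HasFDerivAt (fun x : E3 => (c + m • x) j)
        (m • (EuclideanSpace.proj j : E3 →L[ℝ] ℝ)) x :=
      ((EuclideanSpace.proj j : E3 →L[ℝ] ℝ).hasFDerivAt (x := x)).fun_const_smul m
        |>.const_add (c j)
    have h2 := ((hφ.differentiable (by simp)).differentiableAt (x := x)).hasFDerivAt.mul h1
    rw [HasFDerivAt.fderiv (f := fun x => φ x * (c + m • x) j) h2]
    simp
  simp only [key, Finset.sum_add_distrib, sum_apply_mul_clm]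
  simp
  ring

/-- The continuity equation integrated in time at a fixed point `y`. Writing the divergence as a sum
of partial derivatives prepares for testing against a weakly differentiable function. -/
theorem transported_sub_eq {φ : E3 → ℝ} (hφ : ContDiff ℝ ∞ φ) (c : E3) {m T : ℝ} (hm : 0 ≤ m)
    (hT : 0 ≤ T) (y : E3) :
    (1 + T * m)⁻¹ ^ 3 * φ (flowInv c m T y) - φ y = -∫ t in Set.Ioc 0 T, ∑ j,
      (1 + t * m)⁻¹ ^ 4 * fderiv ℝ (fun x => φ x * (c + m • x) j) (flowInv c m t y)
        (EuclideanSpace.single j 1) := by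
  have hpos : ∀ t ∈ Set.uIcc 0 T, 0 < 1 + t * m := by
    intro t ht
    rw [Set.uIcc_of_le hT] at ht
    nlinarith [ht.1, mul_nonneg ht.1 hm]
  simp only [← Finset.mul_sum, sum_fderiv_mul_field hφ]
  rw [← intervalIntegral.integral_of_le hT, ← intervalIntegral.integral_neg]
  rw [intervalIntegral.integral_eq_sub_of_hasDerivAt
    (fun t ht => hasDerivAt_transported hφ c (hpos t ht) y)]
  · simp [flowInv]
  · apply ContinuousOn.intervalIntegrable
    have h1 : ContinuousOn (fun t : ℝ => (1 + t * m)⁻¹) (Set.uIcc 0 T) :=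
      ContinuousOn.inv₀ (by fun_prop) fun t ht => (hpos t ht).ne'
    have h2 : ContinuousOn (fun t : ℝ => flowInv c m t y) (Set.uIcc 0 T) := by
      unfold flowInv
      exact h1.smul (by fun_prop)
    have h3 : ContinuousOn (fun t : ℝ => fderiv ℝ φ (flowInv c m t y)) (Set.uIcc 0 T) :=
      (hφ.continuous_fderiv (by simp)).comp_continuousOn h2
    have h4 : ContinuousOn (fun t : ℝ => φ (flowInv c m t y)) (Set.uIcc 0 T) :=
      hφ.continuous.comp_continuousOn h2
    exact ((h1.pow 4).mul ((h3.clm_apply (continuousOn_const.add (h2.const_smul m))).add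
      (h4.const_mul _))).neg

/-- At each fixed time the map is an invertible affine map, so it pulls null sets back to null sets;
Fubini does the rest. This lets functions known only up to null sets be composed with the motion. -/
theorem quasiMeasurePreserving_flow (c : E3) {m T : ℝ} (hm : 0 ≤ m) :
    Measure.QuasiMeasurePreserving (fun p : ℝ × E3 => p.2 + p.1 • (c + m • p.2))
      ((volume.restrict (Set.Ioc 0 T)).prod volume) volume := by
  have hmeas : Measurable fun p : ℝ × E3 => p.2 + p.1 • (c + m • p.2) := by fun_prop
  refine ⟨hmeas, Measure.AbsolutelyContinuous.mk fun N hN h0 => ?_⟩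
  rw [Measure.map_apply hmeas hN, Measure.measure_prod_null (hmeas hN)]
  refine (ae_restrict_iff' measurableSet_Ioc).2 (Eventually.of_forall fun t ht => ?_)
  have hpos : 0 < 1 + t * m := by nlinarith [ht.1, mul_nonneg ht.1.le hm]
  have : Prod.mk t ⁻¹' ((fun p : ℝ × E3 => p.2 + p.1 • (c + m • p.2)) ⁻¹' N)
      = (fun x => (1 + t * m) • x + t • c) ⁻¹' N := by
    ext x
    simp only [Set.mem_preimage, flow_eq]
  simp only [Pi.zero_apply]
  rw [this, ← Measure.map_apply (by fun_prop) hN, map_affine_volume hpos]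
  simp [h0]

theorem integrable_comp_flow {F : Type*} [NormedAddCommGroup F] {g : E3 → F} (hg : Integrable g)
    (c : E3) {m T : ℝ} (hm : 0 ≤ m) :
    Integrable (fun p : ℝ × E3 => g (p.2 + p.1 • (c + m • p.2)))
      ((volume.restrict (Set.Ioc 0 T)).prod volume) := by
  have hmeas := hg.aestronglyMeasurable.comp_quasiMeasurePreserving
    (quasiMeasurePreserving_flow c (T := T) hm)
  refine ⟨hmeas, ?_⟩
  rw [hasFiniteIntegral_iff_enorm]
  rw [lintegral_prod (fun a : ℝ × E3 => ‖g (a.2 + a.1 • (c + m • a.2))‖ₑ) hmeas.enorm]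
  calc _ ≤ ∫⁻ t in Set.Ioc 0 T, ∫⁻ x, ‖g x‖ₑ := by
        refine lintegral_mono_ae ?_
        refine (ae_restrict_iff' measurableSet_Ioc).2 (Eventually.of_forall fun t ht => ?_)
        simp only [flow_eq]
        exact lintegral_comp_affine_le (fun x => ‖g x‖ₑ) (by nlinarith [mul_nonneg ht.1.le hm]) _
    _ < ⊤ := by
        rw [setLIntegral_const]
        exact ENNReal.mul_lt_top hg.2 (by simp)

theorem tsupport_transported_subset {χ : E3 → ℝ} (c : E3) {m t : ℝ} (h : 0 < 1 + t * m) (a : ℝ) :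
    tsupport (fun z => a * χ (flowInv c m t z)) ⊆
      (fun x => x + t • (c + m • x)) '' tsupport χ := by
  have hcl : IsClosed ((fun x => x + t • (c + m • x)) '' tsupport χ) := by
    simp only [flow_eq]
    exact ((Homeomorph.smulOfNeZero (α := E3) _ h.ne').trans
      (Homeomorph.addRight (t • c))).isClosedMap _ (isClosed_tsupport _)
  refine closure_minimal (fun z hz => ?_) hcl
  refine ⟨flowInv c m t z, subset_tsupport _ fun h0 => hz ?_, flow_flowInv c h z⟩
  simp [h0]

/-- The push-forward of `χ` is itself an admissible test function, since `hseg` keeps its support in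
`U`. Differentiating it costs a fourth power of `(1 + t * m)⁻¹`; the cube is absorbed by the change
of variables on the right. -/
theorem HasWeakPartial.integral_transported {U : Set E3} (hU : IsOpen U) {j : Fin 3}
    {u g : E3 → E3} (h : HasWeakPartial U j u g) (c : E3) {m t : ℝ} (hp : 0 < 1 + t * m)
    {χ : E3 → ℝ} (hχ : ContDiff ℝ ∞ χ) (hχc : HasCompactSupport χ)
    (hseg : ∀ x ∈ tsupport χ, x + t • (c + m • x) ∈ U) :
    ∫ y, ((1 + t * m)⁻¹ ^ 4 * fderiv ℝ χ (flowInv c m t y)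
        (EuclideanSpace.single j 1)) • U.indicator u y =
      -∫ x, χ x • U.indicator g (x + t • (c + m • x)) := by
  set κ : E3 → ℝ := fun z => (1 + t * m)⁻¹ ^ 3 * χ (flowInv c m t z) with hκ
  have hκs : ContDiff ℝ ∞ κ := by
    refine contDiff_const.mul (hχ.comp ?_)
    unfold flowInv
    fun_prop
  have hsub := tsupport_transported_subset (χ := χ) c hp ((1 + t * m)⁻¹ ^ 3)
  have hκU : tsupport κ ⊆ U := by
    refine hsub.trans ?_
    rintro _ ⟨x, hx, rfl⟩
    exact hseg x hx
  have hκc : HasCompactSupport κ :=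
    (hχc.image (by fun_prop)).of_isClosed_subset (isClosed_tsupport _) hsub
  have := h κ hκs hκc hκU
  rw [setIntegral_smul_eq_indicator hU.measurableSet,
    setIntegral_smul_eq_indicator hU.measurableSet] at this
  rw [show (∫ y, ((1 + t * m)⁻¹ ^ 4 * fderiv ℝ χ (flowInv c m t y)
      (EuclideanSpace.single j 1)) • U.indicator u y) =
      ∫ y, fderiv ℝ κ y (EuclideanSpace.single j 1) • U.indicator u y from
    integral_congr_ae (Eventually.of_forall fun y => by
      simp only [hκ, fderiv_transported hχ]), this]
  have cv := integral_comp_affine (fun y => χ (flowInv c m t y) • U.indicator g y) hp (t • c)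
  simp only [flowInv_flow c hp] at cv
  simp only [← flow_eq] at cv
  rw [cv, ← integral_smul]
  simp only [hκ, smul_smul, inv_pow]

/-- Weak chain rule for an affine map. Negative `m` is allowed, which the contraction in `dilAvg`
requires. -/
theorem HasWeakPartial.integral_partial_smul_comp_flow {U : Set E3} (hU : IsOpen U) {j : Fin 3}
    {u g : E3 → E3} (h : HasWeakPartial U j u g) (c : E3) {m t : ℝ} (hp : 0 < 1 + t * m)
    {χ : E3 → ℝ} (hχ : ContDiff ℝ ∞ χ) (hχc : HasCompactSupport χ)
    (hseg : ∀ x ∈ tsupport χ, x + t • (c + m • x) ∈ U) :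
    ∫ x, fderiv ℝ χ x (EuclideanSpace.single j 1) • U.indicator u (x + t • (c + m • x)) =
      -∫ x, χ x • (1 + t * m) • U.indicator g (x + t • (c + m • x)) := by
  have cv := integral_comp_affine (fun y => fderiv ℝ χ (flowInv c m t y)
    (EuclideanSpace.single j 1) • U.indicator u y) hp (t • c)
  simp only [flowInv_flow c hp] at cv
  simp only [← flow_eq] at cv
  simp only [smul_comm (χ _) (1 + t * m)]
  rw [cv, integral_smul, ← smul_neg, ← h.integral_transported hU c hp hχ hχc hseg, ← integral_smul,
    ← integral_smul]
  refine integral_congr_ae (Eventually.of_forall fun y => ?_)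
  simp only [smul_smul]
  congr 1
  have := hp.ne'
  field_simp

/-- Duality: the motion is moved from `u` onto the smooth `φ`, where the classical identity
`transported_sub_eq` applies, and the weak derivative then moves the partial derivatives back onto
`u`. The condition `0 ≤ m` keeps the Jacobian at least `1`, which gives the uniform bounds behind
Fubini. -/
theorem integral_test_smul_flow {U A : Set E3} (hU : IsOpen U)
    {u : E3 → E3} {G : Fin 3 → E3 → E3} (hu : IntegrableOn u U) (hG : ∀ j, IntegrableOn (G j) U)
    (h : ∀ j, HasWeakPartial U j u (G j)) (c : E3) {m T : ℝ} (hm : 0 ≤ m) (hT : 0 ≤ T)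
    {φ : E3 → ℝ} (hφ : ContDiff ℝ ∞ φ) (hφc : HasCompactSupport φ) (hφA : tsupport φ ⊆ A)
    (hseg : ∀ x ∈ A, ∀ t ∈ Set.Icc 0 T, x + t • (c + m • x) ∈ U) :
    ∫ x, φ x • (U.indicator u (x + T • (c + m • x)) - U.indicator u x -
      ∑ j, (c + m • x) j • ∫ t in Set.Ioc 0 T, U.indicator (G j) (x + t • (c + m • x))) = 0 := by
  have hpos : ∀ t, 0 ≤ t → 1 ≤ 1 + t * m := fun t ht => by nlinarith [mul_nonneg ht hm]
  have hpos' : ∀ t, 0 ≤ t → 0 < 1 + t * m := fun t ht => by linarith [hpos t ht]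
  set u0 := U.indicator u with hu0
  set G0 : Fin 3 → E3 → E3 := fun j => U.indicator (G j) with hG0
  have iu0 : Integrable u0 := hu.integrable_indicator hU.measurableSet
  have iG0 : ∀ j, Integrable (G0 j) := fun j => (hG j).integrable_indicator hU.measurableSet
  have iuT : Integrable fun x => u0 (x + T • (c + m • x)) := by
    simp only [flow_eq]
    exact integrable_comp_affine iu0 (hpos' T hT) _
  set χ : Fin 3 → E3 → ℝ := fun j x => φ x * (c + m • x) j with hχ
  have hχs : ∀ j, ContDiff ℝ ∞ (χ j) := contDiff_mul_field hφ c m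
  have hχc : ∀ j, HasCompactSupport (χ j) := fun j => hφc.mul_right
  have hχt : ∀ j, tsupport (χ j) ⊆ tsupport φ := fun j => tsupport_mul_subset_left
  have stepB : ∀ j, ∀ t ∈ Set.Ioc 0 T,
      ∫ y, ((1 + t * m)⁻¹ ^ 4 * fderiv ℝ (χ j) (flowInv c m t y)
        (EuclideanSpace.single j 1)) • u0 y =
      -∫ x, χ j x • G0 j (x + t • (c + m • x)) := fun j t ht =>
    (h j).integral_transported hU c (hpos' t ht.1.le) (hχs j) (hχc j) fun x hx =>
      hseg x (hφA (hχt j hx)) t ⟨ht.1.le, ht.2⟩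
  have hint : ∀ j, Integrable (Function.uncurry fun (t : ℝ) (y : E3) =>
      ((1 + t * m)⁻¹ ^ 4 * fderiv ℝ (χ j) (flowInv c m t y)
        (EuclideanSpace.single j 1)) • u0 y)
      ((volume.restrict (Set.Ioc 0 T)).prod volume) := by
    intro j
    have hcp := continuous_partial (hχs j) (EuclideanSpace.single j 1)
    obtain ⟨C, hC⟩ := (hasCompactSupport_partial (hχc j)
      (EuclideanSpace.single j 1)).exists_bound_of_continuous hcp
    refine (iu0.comp_snd (volume.restrict (Set.Ioc 0 T))).bdd_smul C
      (φ := fun p => (1 + p.1 * m)⁻¹ ^ 4 * fderiv ℝ (χ j) (flowInv c m p.1 p.2)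
        (EuclideanSpace.single j 1)) ?_ ?_
    · exact (Measurable.mul (by fun_prop)
        (hcp.measurable.comp (measurable_flowInv c m))).aestronglyMeasurable
    · have : ∀ᵐ p ∂((volume.restrict (Set.Ioc 0 T)).prod (volume : Measure E3)),
          p.1 ∈ Set.Ioc 0 T :=
        Measure.quasiMeasurePreserving_fst.ae (ae_restrict_mem measurableSet_Ioc)
      filter_upwards [this] with p hp
      rw [norm_mul]
      have h1 : ‖(1 + p.1 * m)⁻¹ ^ 4‖ ≤ 1 := by
        rw [norm_pow, norm_inv, Real.norm_of_nonneg (hpos' _ hp.1.le).le]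
        exact pow_le_one₀ (inv_nonneg.2 (hpos' _ hp.1.le).le)
          (inv_le_one_of_one_le₀ (hpos _ hp.1.le))
      calc _ ≤ 1 * C := mul_le_mul h1 (hC _) (norm_nonneg _) zero_le_one
        _ = C := one_mul C
  have hint' : ∀ j, Integrable (Function.uncurry fun (t : ℝ) (x : E3) =>
      χ j x • G0 j (x + t • (c + m • x)))
      ((volume.restrict (Set.Ioc 0 T)).prod volume) := by
    intro j
    obtain ⟨C, hC⟩ := (hχc j).exists_bound_of_continuous (hχs j).continuous
    exact (integrable_comp_flow (iG0 j) c (T := T) hm).bdd_smul C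
      (φ := fun p => χ j p.2) ((hχs j).continuous.comp continuous_snd).aestronglyMeasurable
      (Eventually.of_forall fun p => hC _)
  -- After a change of variables the left side tests `u0` against the density transported up to time
  -- `T` minus the initial density.
  have stepA : ∫ x, φ x • (u0 (x + T • (c + m • x)) - u0 x) =
      -∑ j, ∫ y, ∫ t in Set.Ioc 0 T, ((1 + t * m)⁻¹ ^ 4 *
        fderiv ℝ (χ j) (flowInv c m t y) (EuclideanSpace.single j 1)) • u0 y := by
    have hp := hpos' T hT
    have cv := integral_comp_affine (fun y => φ (flowInv c m T y) • u0 y) hp (T • c)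
    simp only [flowInv_flow c hp] at cv
    simp only [← flow_eq] at cv
    have i1 : Integrable fun y => ((1 + T * m) ^ 3)⁻¹ • φ (flowInv c m T y) • u0 y := by
      obtain ⟨C, hC⟩ := hφc.exists_bound_of_continuous hφ.continuous
      refine Integrable.smul ((1 + T * m) ^ 3)⁻¹ <| iu0.bdd_smul C (φ := fun y => φ (flowInv c m T y)) ?_
        (Eventually.of_forall fun p => hC _)
      refine (hφ.continuous.comp ?_).aestronglyMeasurable
      unfold flowInv
      fun_prop
    have i3 : ∀ j, Integrable fun y => ∫ t in Set.Ioc 0 T, ((1 + t * m)⁻¹ ^ 4 *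
        fderiv ℝ (χ j) (flowInv c m t y) (EuclideanSpace.single j 1)) • u0 y := fun j =>
      (hint j).integral_prod_right
    simp only [smul_sub]
    rw [integral_sub (integrable_test_smul iuT hφ.continuous hφc)
      (integrable_test_smul iu0 hφ.continuous hφc), cv, ← integral_smul,
      ← integral_sub i1 (integrable_test_smul iu0 hφ.continuous hφc),
      ← integral_finsetSum _ fun j _ => i3 j, ← integral_neg]
    have hae : ∀ᵐ y : E3, ∀ j, Integrable (fun t : ℝ => ((1 + t * m)⁻¹ ^ 4 *
        fderiv ℝ (χ j) (flowInv c m t y) (EuclideanSpace.single j 1)) • u0 y)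
        (volume.restrict (Set.Ioc 0 T)) :=
      ae_all_iff.2 fun j => (hint j).prod_left_ae
    refine integral_congr_ae ?_
    filter_upwards [hae] with y hy
    rw [← integral_finsetSum _ fun j _ => hy j]
    simp only [← Finset.sum_smul]
    rw [integral_smul_const, ← neg_smul, ← transported_sub_eq hφ c hm hT y, sub_smul,
      smul_smul, inv_pow]
  -- Fubini, then `stepB` at each time, then Fubini back.
  have hsum : ∀ j, ∫ x, φ x • ((c + m • x) j •
      ∫ t in Set.Ioc 0 T, G0 j (x + t • (c + m • x))) =
      -∫ y, ∫ t in Set.Ioc 0 T, ((1 + t * m)⁻¹ ^ 4 *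
        fderiv ℝ (χ j) (flowInv c m t y) (EuclideanSpace.single j 1)) • u0 y := by
    intro j
    rw [← integral_integral_swap (hint j), setIntegral_congr_fun measurableSet_Ioc (stepB j),
      integral_neg, neg_neg, integral_integral_swap (hint' j)]
    simp only [integral_smul, smul_smul, hχ]
  have i2 : ∀ j, Integrable fun x => φ x • ((c + m • x) j •
      ∫ t in Set.Ioc 0 T, G0 j (x + t • (c + m • x))) := by
    intro j
    have := (hint' j).integral_prod_right
    simpa only [Function.uncurry_apply_pair, integral_smul, smul_smul, hχ] using this
  simp only [smul_sub (φ _) (_ - _), Finset.smul_sum]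
  rw [integral_sub (f := fun x => φ x • (u0 (x + T • (c + m • x)) - u0 x))
      (integrable_test_smul (iuT.sub iu0) hφ.continuous hφc)
    (integrable_finsetSum _ fun j _ => i2 j), integral_finsetSum _ fun j _ => i2 j]
  simp only [hsum, stepA, Finset.sum_neg_distrib, sub_self]

theorem locallyIntegrableOn_sum_smul {A : Set E3} (hA : IsOpen A) {a : Fin 3 → E3 → ℝ}
    (ha : ∀ j, Continuous (a j)) {f : Fin 3 → E3 → E3} (hf : ∀ j, Integrable (f j)) :
    LocallyIntegrableOn (fun x => ∑ j, a j x • f j x) A := by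
  have (j : Fin 3) : LocallyIntegrableOn (fun x => a j x • f j x) A :=
    LocallyIntegrableOn.continuousOn_smul hA.isLocallyClosed
      ((hf j).locallyIntegrable.locallyIntegrableOn _) (ha j).continuousOn
  simp only [Fin.sum_univ_three]
  exact ((this 0).add (this 1)).add (this 2)

/-- The tested identity holds for every `φ` supported in `A`, so the integrand vanishes almost
everywhere there. The exceptional null set may depend on `T`. -/
theorem ae_sub_eq_integral_flow {U A : Set E3} (hU : IsOpen U) (hA : IsOpen A)
    {u : E3 → E3} {G : Fin 3 → E3 → E3} (hu : IntegrableOn u U) (hG : ∀ j, IntegrableOn (G j) U)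
    (h : ∀ j, HasWeakPartial U j u (G j)) (c : E3) {m T : ℝ} (hm : 0 ≤ m) (hT : 0 ≤ T)
    (hseg : ∀ x ∈ A, ∀ t ∈ Set.Icc 0 T, x + t • (c + m • x) ∈ U) :
    ∀ᵐ x, x ∈ A → u (x + T • (c + m • x)) - u x =
      ∫ t in Set.Ioc 0 T, ∑ j, (c + m • x) j • U.indicator (G j) (x + t • (c + m • x)) := by
  have iu0 : Integrable (U.indicator u) := hu.integrable_indicator hU.measurableSet
  have iG0 : ∀ j, Integrable (U.indicator (G j)) := fun j =>
    (hG j).integrable_indicator hU.measurableSet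
  have iuT : Integrable fun x => U.indicator u (x + T • (c + m • x)) := by
    simp only [flow_eq]
    exact integrable_comp_affine iu0 (by nlinarith [mul_nonneg hT hm]) _
  have iI : ∀ j, Integrable fun x => ∫ t in Set.Ioc 0 T,
      U.indicator (G j) (x + t • (c + m • x)) := fun j =>
    (integrable_comp_flow (iG0 j) c (T := T) hm).integral_prod_right
  have hXc : ∀ j, Continuous fun x : E3 => (c + m • x) j := fun j => by
    simp only [PiLp.add_apply, PiLp.smul_apply]
    fun_prop
  have main := hA.ae_eq_zero_of_integral_contDiff_smul_eq_zero
      (f := fun x => U.indicator u (x + T • (c + m • x)) - U.indicator u x -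
        ∑ j, (c + m • x) j • ∫ t in Set.Ioc 0 T, U.indicator (G j) (x + t • (c + m • x)))
      (LocallyIntegrableOn.sub ((iuT.sub iu0).locallyIntegrable.locallyIntegrableOn _)
        (locallyIntegrableOn_sum_smul hA hXc iI))
      fun φ hφ hφc hφA => integral_test_smul_flow hU hu hG h c hm hT hφ hφc hφA hseg
  have hfib : ∀ᵐ x, ∀ j, Integrable (fun t : ℝ => U.indicator (G j) (x + t • (c + m • x)))
      (volume.restrict (Set.Ioc 0 T)) :=
    ae_all_iff.2 fun j => (integrable_comp_flow (iG0 j) c (T := T) hm).prod_left_ae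
  filter_upwards [main, hfib] with x hx hfx hxA
  have h0 : x ∈ U := by simpa using hseg x hxA 0 ⟨le_rfl, hT⟩
  have h1 := hx hxA
  rw [Set.indicator_of_mem (hseg x hxA T ⟨hT, le_rfl⟩), Set.indicator_of_mem h0,
    sub_eq_zero] at h1
  have h2 : ∀ j, Integrable (fun t : ℝ => (c + m • x) j • U.indicator (G j) (x + t • (c + m • x)))
      (volume.restrict (Set.Ioc 0 T)) := fun j => (hfx j).smul ((c + m • x) j)
  rw [h1, integral_finsetSum _ fun j _ => h2 j]
  simp only [integral_smul]

/-! ### `L²` inequalities and the translation estimate. -/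

theorem sq_eLpNorm_two {α ε : Type*} [MeasurableSpace α] [ENorm ε] (f : α → ε) (μ : Measure α) :
    eLpNorm f 2 μ ^ 2 = ∫⁻ x, ‖f x‖ₑ ^ 2 ∂μ := by
  have := eLpNorm_nnreal_pow_eq_lintegral (μ := μ) (f := f) (p := 2) (by norm_num)
  simpa using this

theorem eLpNorm_two_le_iff {α ε : Type*} [MeasurableSpace α] [ENorm ε] {f : α → ε}
    {μ : Measure α} {a : ℝ≥0∞} : eLpNorm f 2 μ ≤ a ↔ ∫⁻ x, ‖f x‖ₑ ^ 2 ∂μ ≤ a ^ 2 := by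
  rw [← sq_eLpNorm_two]
  exact (ENNReal.pow_le_pow_left_iff two_ne_zero).symm

theorem sq_lintegral_le {α : Type*} [MeasurableSpace α] {μ : Measure α} {f : α → ℝ≥0∞}
    (hf : AEMeasurable f μ) : (∫⁻ x, f x ∂μ) ^ 2 ≤ μ Set.univ * ∫⁻ x, f x ^ 2 ∂μ := by
  have h := ENNReal.lintegral_mul_le_Lp_mul_Lq μ Real.HolderConjugate.two_two hf
    (aemeasurable_const (b := (1 : ℝ≥0∞)))
  have h2 : (∫⁻ x, f x ∂μ) ≤ (∫⁻ x, f x ^ 2 ∂μ) ^ (1 / 2 : ℝ) * μ Set.univ ^ (1 / 2 : ℝ) := by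
    simpa using h
  calc _ ≤ ((∫⁻ x, f x ^ 2 ∂μ) ^ (1 / 2 : ℝ) * μ Set.univ ^ (1 / 2 : ℝ)) ^ 2 := by gcongr
    _ = _ := by
      rw [mul_pow, ← ENNReal.rpow_natCast, ← ENNReal.rpow_natCast, ← ENNReal.rpow_mul,
        ← ENNReal.rpow_mul, mul_comm]
      norm_num

theorem eLpNorm_restrict_union_le {F : Type*} [NormedAddCommGroup F] (f : E3 → F) (s t : Set E3) :
    eLpNorm f 2 (volume.restrict (s ∪ t)) ≤
      eLpNorm f 2 (volume.restrict s) + eLpNorm f 2 (volume.restrict t) := by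
  rw [eLpNorm_two_le_iff]
  calc _ ≤ ∫⁻ x, ‖f x‖ₑ ^ 2 ∂(volume.restrict s + volume.restrict t) :=
        lintegral_mono' (Measure.restrict_union_le s t) le_rfl
    _ = eLpNorm f 2 (volume.restrict s) ^ 2 + eLpNorm f 2 (volume.restrict t) ^ 2 := by
        rw [lintegral_add_measure, sq_eLpNorm_two, sq_eLpNorm_two]
    _ ≤ _ := by
        rw [add_sq]
        gcongr
        exact le_self_add

theorem eLpNorm_restrict_mono {F : Type*} [NormedAddCommGroup F] (f : E3 → F) {s t : Set E3}
    (h : s ⊆ t) : eLpNorm f 2 (volume.restrict s) ≤ eLpNorm f 2 (volume.restrict t) :=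
  eLpNorm_mono_measure f (Measure.restrict_mono_set _ h)

/-- The sum of the `L²(U)` norms of the weak partial derivatives of `u`. -/
noncomputable def gradSum (U : Set E3) (u : E3 → E3) : ℝ≥0∞ :=
  ∑ j, eLpNorm (weakPartial U j u) 2 (volume.restrict U)

/-- The pointwise sum of the norms of the weak partial derivatives, extended by zero. -/
noncomputable def gradPt (U : Set E3) (u : E3 → E3) (x : E3) : ℝ≥0∞ :=
  ∑ j, ‖U.indicator (weakPartial U j u) x‖ₑ

theorem MemH1.gradSum_lt_top {U : Set E3} {u : E3 → E3} (hu : MemH1 U u) : gradSum U u < ⊤ :=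
  ENNReal.sum_lt_top.2 fun j _ => (hu.memLp_weakPartial j).2

theorem MemH1.aemeasurable_gradPt {U : Set E3} (hU : IsOpen U) {u : E3 → E3} (hu : MemH1 U u) :
    AEMeasurable (gradPt U u) :=
  Finset.aemeasurable_fun_sum _ fun j _ => by
    have := (aestronglyMeasurable_indicator_iff hU.measurableSet).2 (hu.memLp_weakPartial j).1
    exact this.enorm

theorem MemH1.lintegral_sq_gradPt_le {U : Set E3} (hU : IsOpen U) {u : E3 → E3}
    (hu : MemH1 U u) : ∫⁻ x, gradPt U u x ^ 2 ≤ gradSum U u ^ 2 := by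
  have h1 : ∀ j ∈ Finset.univ, AEStronglyMeasurable
      (fun x => ‖U.indicator (weakPartial U j u) x‖) volume := fun j _ =>
    ((aestronglyMeasurable_indicator_iff hU.measurableSet).2 (hu.memLp_weakPartial j).1).norm
  have h2 := eLpNorm_sum_le h1 (p := 2) (by norm_num)
  simp only [eLpNorm_norm, eLpNorm_indicator_eq_eLpNorm_restrict hU.measurableSet] at h2
  rw [eLpNorm_two_le_iff] at h2
  refine le_trans (lintegral_mono fun x => ?_) h2
  gcongr
  simp only [Finset.sum_apply]
  rw [Real.enorm_of_nonneg (Finset.sum_nonneg fun _ _ => norm_nonneg _),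
    ENNReal.ofReal_sum_of_nonneg fun _ _ => norm_nonneg _]
  simp [gradPt]

/-- Cauchy–Schwarz in `t` yields one factor `T`, Tonelli and integration over the time interval the
other. The change of variables in `x` costs nothing because the Jacobian is at least `1`. -/
theorem lintegral_sq_flow_le {g : E3 → ℝ≥0∞} (hg : AEMeasurable g) (c : E3) {m T : ℝ}
    (hm : 0 ≤ m) :
    ∫⁻ x, (∫⁻ t in Set.Ioc 0 T, g (x + t • (c + m • x))) ^ 2 ≤
      ENNReal.ofReal T ^ 2 * ∫⁻ x, g x ^ 2 := by
  have hq := quasiMeasurePreserving_flow c (T := T) hm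
  have hmeas : AEMeasurable (fun p : ℝ × E3 => g (p.2 + p.1 • (c + m • p.2)))
      ((volume.restrict (Set.Ioc 0 T)).prod volume) := hg.comp_quasiMeasurePreserving hq
  have hfib : ∀ᵐ x : E3, AEMeasurable (fun t => g (x + t • (c + m • x)))
      (volume.restrict (Set.Ioc 0 T)) := by
    have := (hmeas.comp_quasiMeasurePreserving
      (Measure.measurePreserving_swap (μ := (volume : Measure E3))
        (ν := volume.restrict (Set.Ioc 0 T))).quasiMeasurePreserving)
    exact this.aestronglyMeasurable.prodMk_left.mono fun x hx => hx.aemeasurable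
  calc _ ≤ ∫⁻ x, ENNReal.ofReal T * ∫⁻ t in Set.Ioc 0 T, g (x + t • (c + m • x)) ^ 2 := by
        refine lintegral_mono_ae ?_
        filter_upwards [hfib] with x hx
        simpa using sq_lintegral_le hx
    _ = ENNReal.ofReal T * ∫⁻ t in Set.Ioc 0 T, ∫⁻ x, g (x + t • (c + m • x)) ^ 2 := by
        rw [lintegral_const_mul' _ _ ENNReal.ofReal_ne_top]
        rw [lintegral_lintegral_swap (f := fun (t : ℝ) (x : E3) => g (x + t • (c + m • x)) ^ 2)
          (hmeas.pow_const 2)]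
    _ ≤ ENNReal.ofReal T * ∫⁻ t in Set.Ioc 0 T, ∫⁻ x, g x ^ 2 := by
        gcongr ENNReal.ofReal T * ?_
        refine lintegral_mono_ae ?_
        refine (ae_restrict_iff' measurableSet_Ioc).2 (Eventually.of_forall fun t ht => ?_)
        simp only [flow_eq]
        exact lintegral_comp_affine_le (fun x => g x ^ 2) (by nlinarith [mul_nonneg ht.1.le hm]) _
    _ = _ := by
        rw [setLIntegral_const]
        simp only [Real.volume_Ioc, sub_zero]
        ring

theorem enorm_sum_smul_le (X : E3) (U : Set E3) (u : E3 → E3) (y : E3) :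
    ‖∑ j, X j • U.indicator (weakPartial U j u) y‖ₑ ≤ ‖X‖ₑ * gradPt U u y := by
  refine (enorm_sum_le _ _).trans ?_
  rw [gradPt, Finset.mul_sum]
  refine Finset.sum_le_sum fun j _ => ?_
  rw [enorm_smul]
  gcongr
  exact enorm_le_iff_norm_le.2 (PiLp.norm_apply_le X j)

/-- The case `m = 0`, `T = 1` of the segment formula: the field is the constant `h`. -/
theorem MemH1.eLpNorm_shift_sub_le {U A : Set E3} (hU : IsOpen U) (hb : Bornology.IsBounded U)
    (hA : IsOpen A) {u : E3 → E3} (hu : MemH1 U u) {h : E3}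
    (hseg : ∀ x ∈ A, ∀ t ∈ Set.Icc (0 : ℝ) 1, x + t • h ∈ U) :
    eLpNorm (fun x => u (x + h) - u x) 2 (volume.restrict A) ≤ ‖h‖ₑ * gradSum U u := by
  have key := ae_sub_eq_integral_flow hU hA (integrableOn_of_memLp_two hb hu.1)
    (fun j => integrableOn_of_memLp_two hb (hu.memLp_weakPartial j)) hu.hasWeakPartial h
    (le_refl (0 : ℝ)) zero_le_one (by simpa using hseg)
  rw [eLpNorm_two_le_iff]
  calc _ ≤ ∫⁻ x in A, (‖h‖ₑ * ∫⁻ t in Set.Ioc (0 : ℝ) 1, gradPt U u (x + t • (h + (0 : ℝ) • x))) ^ 2 := by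
        refine lintegral_mono_ae ?_
        rw [ae_restrict_iff' hA.measurableSet]
        filter_upwards [key] with x hx hxA
        have := hx hxA
        simp only [zero_smul, add_zero, one_smul] at this ⊢
        gcongr
        rw [this, ← lintegral_const_mul' _ _ enorm_ne_top]
        refine (enorm_integral_le_lintegral_enorm _).trans (lintegral_mono fun t => ?_)
        exact enorm_sum_smul_le _ _ _ _
    _ ≤ ∫⁻ x, (‖h‖ₑ * ∫⁻ t in Set.Ioc (0 : ℝ) 1, gradPt U u (x + t • (h + (0 : ℝ) • x))) ^ 2 :=
        setLIntegral_le_lintegral _ _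
    _ ≤ ‖h‖ₑ ^ 2 * (ENNReal.ofReal 1 ^ 2 * ∫⁻ x, gradPt U u x ^ 2) := by
        simp only [mul_pow]
        rw [lintegral_const_mul' _ _ (by simp)]
        gcongr
        exact lintegral_sq_flow_le (hu.aemeasurable_gradPt hU) h le_rfl
    _ ≤ _ := by
        rw [ENNReal.ofReal_one, one_pow, one_mul, mul_pow]
        gcongr
        exact hu.lintegral_sq_gradPt_le hU

/-! ### Propagation of local `L²` bounds. -/

/-- Near `x`, the `L²` norm of `u` is controlled by `N`, uniformly for `(u, N) ∈ Q`. -/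
def LocalBound (U : Set E3) (Q : Set ((E3 → E3) × ℝ≥0∞)) (x : E3) : Prop :=
  ∃ ε > 0, ∃ C : ℝ≥0, ∀ p ∈ Q,
    eLpNorm p.1 2 (volume.restrict (Metric.ball x ε ∩ U)) ≤ C * p.2

theorem isOpen_localBound (U : Set E3) (Q : Set ((E3 → E3) × ℝ≥0∞)) :
    IsOpen {x | LocalBound U Q x} := by
  rw [Metric.isOpen_iff]
  rintro x ⟨ε, hε, C, h⟩
  refine ⟨ε, hε, fun y hy => ⟨ε - dist y x, sub_pos.2 hy, C, fun p hp => ?_⟩⟩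
  refine (eLpNorm_restrict_mono _ (Set.inter_subset_inter_left _ ?_)).trans (h p hp)
  exact Metric.ball_subset_ball' (by linarith)

/-- Write `u x = u (x + h) - (u (x + h) - u x)`: the first term is bounded near `y + h`, the second
by the gradient. The point `y` need not belong to `U`, so boundary points are covered. -/
theorem LocalBound.of_shift {U : Set E3} (hU : IsOpen U) (hb : Bornology.IsBounded U)
    {Q : Set ((E3 → E3) × ℝ≥0∞)} (hQ : ∀ p ∈ Q, MemH1 U p.1 ∧ gradSum U p.1 ≤ p.2)
    {y h : E3} {δ : ℝ} (hδ : 0 < δ)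
    (hseg : ∀ x ∈ Metric.ball y δ ∩ U, ∀ t ∈ Set.Icc (0 : ℝ) 1, x + t • h ∈ U)
    (hyh : LocalBound U Q (y + h)) : LocalBound U Q y := by
  obtain ⟨ε, hε, C, hC⟩ := hyh
  refine ⟨min δ ε, lt_min hδ hε, C + ‖h‖₊, fun p hp => ?_⟩
  set A := Metric.ball y (min δ ε) ∩ U
  set B := Metric.ball (y + h) ε ∩ U
  have hA : IsOpen A := Metric.isOpen_ball.inter hU
  have hB : IsOpen B := Metric.isOpen_ball.inter hU
  obtain ⟨hu, hN⟩ := hQ p hp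
  have hsegA : ∀ x ∈ A, ∀ t ∈ Set.Icc (0 : ℝ) 1, x + t • h ∈ U := fun x hx =>
    hseg x ⟨Metric.ball_subset_ball (min_le_left _ _) hx.1, hx.2⟩
  have hAB : A ⊆ (fun x => x + h) ⁻¹' B := fun x hx => by
    refine ⟨?_, by simpa using hsegA x hx 1 ⟨zero_le_one, le_rfl⟩⟩
    simpa using Metric.ball_subset_ball (min_le_right _ _) hx.1
  have hmp := (measurePreserving_add_right (volume : Measure E3) h).restrict_preimage
    hB.measurableSet
  have huB : AEStronglyMeasurable p.1 (volume.restrict B) :=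
    hu.1.1.mono_measure (Measure.restrict_mono_set _ Set.inter_subset_right)
  have huA : AEStronglyMeasurable p.1 (volume.restrict A) :=
    hu.1.1.mono_measure (Measure.restrict_mono_set _ Set.inter_subset_right)
  have hsh : AEStronglyMeasurable (fun x => p.1 (x + h)) (volume.restrict A) :=
    (huB.comp_measurePreserving hmp).mono_measure (Measure.restrict_mono_set _ hAB)
  have h1 : eLpNorm (fun x => p.1 (x + h)) 2 (volume.restrict A) ≤ C * p.2 :=
    calc _ ≤ eLpNorm (p.1 ∘ fun x => x + h) 2 (volume.restrict ((fun x => x + h) ⁻¹' B)) :=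
          eLpNorm_restrict_mono _ hAB
      _ = eLpNorm p.1 2 (volume.restrict B) := eLpNorm_comp_measurePreserving huB hmp
      _ ≤ _ := hC p hp
  have h2 := hu.eLpNorm_shift_sub_le hU hb hA hsegA
  calc eLpNorm p.1 2 (volume.restrict A)
      = eLpNorm ((fun x => p.1 (x + h)) - fun x => p.1 (x + h) - p.1 x) 2
          (volume.restrict A) := by
        congr 1
        ext1 x
        simp
    _ ≤ _ := eLpNorm_sub_le hsh (hsh.sub huA) (by norm_num)
    _ ≤ C * p.2 + ‖h‖ₑ * p.2 := add_le_add h1 (h2.trans (by gcongr))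
    _ = _ := by
      rw [← add_mul]
      rfl

/-- Compactness of `closure U`: the property of carrying a uniform bound passes to subsets and
finite unions. -/
theorem exists_bound_of_localBound {U : Set E3} (hb : Bornology.IsBounded U)
    {Q : Set ((E3 → E3) × ℝ≥0∞)} (h : ∀ x ∈ closure U, LocalBound U Q x) :
    ∃ C : ℝ≥0, ∀ p ∈ Q, eLpNorm p.1 2 (volume.restrict U) ≤ C * p.2 := by
  have := (hb.isCompact_closure).induction_on
    (p := fun S => ∃ C : ℝ≥0, ∀ p ∈ Q, eLpNorm p.1 2 (volume.restrict (S ∩ U)) ≤ C * p.2)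
    ⟨0, fun p _ => by simp⟩
    (fun s t hst ⟨C, hC⟩ => ⟨C, fun p hp =>
      (eLpNorm_restrict_mono _ (Set.inter_subset_inter_left _ hst)).trans (hC p hp)⟩)
    (fun s t ⟨C, hC⟩ ⟨C', hC'⟩ => ⟨C + C', fun p hp => by
      rw [Set.union_inter_distrib_right]
      refine (eLpNorm_restrict_union_le _ _ _).trans ?_
      push_cast
      rw [add_mul]
      exact add_le_add (hC p hp) (hC' p hp)⟩)
    (fun x hx => by
      obtain ⟨ε, hε, C, hC⟩ := h x hx
      exact ⟨_, mem_nhdsWithin_of_mem_nhds (Metric.ball_mem_nhds x hε), C, hC⟩)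
  obtain ⟨C, hC⟩ := this
  refine ⟨C, fun p hp => ?_⟩
  simpa [Set.inter_eq_right.2 (subset_closure (s := U))] using hC p hp

/-! ### Spreading the bound through the exterior and up to the Lipschitz boundary. -/

theorem isOpen_truncation (D : Set E3) (R : ℝ) : IsOpen (truncation D R) :=
  Metric.isOpen_ball.sdiff isClosed_closure

theorem isBounded_truncation (D : Set E3) (R : ℝ) : Bornology.IsBounded (truncation D R) :=
  Metric.isBounded_ball.subset Set.sdiff_subset

/-- Here `f` is the height above the graph and `e` the upward direction, so `D` is `{f > 0}` near
`p`. Points with `f = 0` lie in the closure because moving up along `e` enters `D`. All that is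
needed later is that moving down along `e` leaves `closure D`. -/
theorem HasLipschitzBoundary.exists_chart {D : Set E3} (hD : HasLipschitzBoundary D) {p : E3}
    (hp : p ∈ frontier D) : ∃ (e : E3) (r : ℝ) (f : E3 → ℝ), 0 < r ∧ ‖e‖ = 1 ∧
      (∀ x (t : ℝ), f (x - t • e) = f x - t) ∧ f p ≤ 0 ∧
      ∀ x ∈ Metric.ball p r, (x ∈ closure D ↔ 0 ≤ f x) := by
  obtain ⟨A, K, φ, r, hr, hφ, h⟩ := hD p hp
  have hφc : Continuous φ := hφ.continuous
  set e : E3 := A.symm (EuclideanSpace.single 2 1)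
  set f : E3 → ℝ := fun x => A x 2 - φ (!₂[A x 0, A x 1]) with hf
  have hfc : Continuous f := by
    have hA : Continuous A := A.continuous
    have h0 (i : Fin 3) : Continuous fun x => A x i := by fun_prop
    refine (h0 2).sub (hφc.comp ?_)
    refine (PiLp.continuous_toLp 2 _).comp ?_
    refine continuous_pi fun i => ?_
    fin_cases i
    · exact h0 0
    · exact h0 1
  have hshift : ∀ x (t : ℝ), f (x - t • e) = f x - t := by
    intro x t
    have : A (x - t • e) = A x - t • EuclideanSpace.single 2 1 := by
      simp [e, map_sub, map_smul]
    simp only [hf, this]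
    simp
    ring
  have hmem : ∀ x ∈ Metric.ball p r, (x ∈ D ↔ 0 < f x) := fun x hx => by
    rw [h x hx, hf, sub_pos]
  have hcl : ∀ x ∈ Metric.ball p r, (x ∈ closure D ↔ 0 ≤ f x) := by
    intro x hx
    constructor
    · intro hxD
      by_contra! hneg
      have hop : IsOpen (Metric.ball p r ∩ f ⁻¹' Set.Iio 0) :=
        Metric.isOpen_ball.inter (isOpen_Iio.preimage hfc)
      obtain ⟨y, hy, hyD⟩ := mem_closure_iff.1 hxD _ hop ⟨hx, hneg⟩
      exact absurd ((hmem y hy.1).1 hyD) (not_lt.2 (le_of_lt hy.2))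
    · intro h0
      have hlim : Tendsto (fun t : ℝ => x - t • e) (𝓝[<] 0) (𝓝 x) := by
        have : Continuous fun t : ℝ => x - t • e := by fun_prop
        simpa using (this.tendsto 0).mono_left nhdsWithin_le_nhds
      refine mem_closure_of_tendsto hlim ?_
      filter_upwards [hlim (Metric.isOpen_ball.mem_nhds hx), self_mem_nhdsWithin] with t ht ht0
      rw [hmem _ ht, hshift]
      have : t < 0 := ht0
      linarith
  refine ⟨e, r, f, hr, by simp [e], hshift, ?_, hcl⟩
  by_contra! hpos
  have hop : IsOpen (Metric.ball p r ∩ f ⁻¹' Set.Ioi 0) :=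
    Metric.isOpen_ball.inter (isOpen_Ioi.preimage hfc)
  have : p ∈ interior D := mem_interior.2
    ⟨_, fun y hy => (hmem y hy.1).2 hy.2, hop, Metric.mem_ball_self hr, hpos⟩
  exact hp.2 this

/-- Open-closed argument: the good points form an open set containing all points of large norm. A
limit of good points lying in the domain is good, by a translation to a nearby good point inside a
small ball. -/
theorem localBound_exterior {D : Set E3} (hD_ext : IsConnected (closure D)ᶜ) {r₁ R : ℝ}
    (hr₁ : r₁ < R) {Q : Set ((E3 → E3) × ℝ≥0∞)}
    (hQ : ∀ p ∈ Q, MemH1 (truncation D R) p.1 ∧ gradSum (truncation D R) p.1 ≤ p.2)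
    (hDR : closure D ⊆ Metric.ball 0 R)
    (hann : ∀ x, r₁ < ‖x‖ → LocalBound (truncation D R) Q x) :
    (closure D)ᶜ ⊆ {x | LocalBound (truncation D R) Q x} := by
  refine hD_ext.isPreconnected.subset_of_closure_inter_subset (isOpen_localBound _ _) ?_ ?_
  · obtain ⟨x, hx⟩ := NormedSpace.exists_lt_norm ℝ E3 (max r₁ R)
    refine ⟨x, fun h => ?_, hann x ((le_max_left _ _).trans_lt hx)⟩
    have := hDR h
    rw [mem_ball_zero_iff] at this
    linarith [le_max_right r₁ R]
  · rintro x ⟨hxS, hxD⟩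
    by_cases hxr : r₁ < ‖x‖
    · exact hann x hxr
    have hxU : x ∈ truncation D R :=
      ⟨by rw [mem_ball_zero_iff]; exact (not_lt.1 hxr).trans_lt hr₁, hxD⟩
    obtain ⟨r, hr, hball⟩ := Metric.isOpen_iff.1 (isOpen_truncation D R) x hxU
    obtain ⟨y, hyS, hy⟩ := Metric.mem_closure_iff.1 hxS r hr
    have hyn : ‖y - x‖ < r := by rwa [← dist_eq_norm, dist_comm]
    -- The radius `r - ‖y - x‖` leaves room for the whole translation inside the ball of radius `r`.
    refine LocalBound.of_shift (isOpen_truncation D R) (isBounded_truncation D R) hQ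
      (h := y - x) (δ := r - ‖y - x‖) (sub_pos.2 hyn) ?_ (by simpa using hyS)
    intro z hz t ht
    apply hball
    rw [Metric.mem_ball, dist_eq_norm]
    have h1 : ‖z - x‖ < r - ‖y - x‖ := by rw [← dist_eq_norm]; exact hz.1
    calc ‖z + t • (y - x) - x‖ = ‖(z - x) + t • (y - x)‖ := by congr 1; abel
      _ ≤ ‖z - x‖ + ‖t • (y - x)‖ := norm_add_le _ _
      _ ≤ ‖z - x‖ + ‖y - x‖ := by
        rw [norm_smul, Real.norm_of_nonneg ht.1]
        gcongr
        exact mul_le_of_le_one_left (norm_nonneg _) ht.2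
      _ < r := by linarith

/-- Only points of `frontier D` remain. There the shift by `-(δ / 2) • e` lowers the chart height,
so it lands outside `closure D`, where the bound is already known, and the segments leading there
stay in the domain. -/
theorem localBound_closure {D : Set E3} (hD_open : IsOpen D) (hD_lip : HasLipschitzBoundary D)
    (hD_ext : IsConnected (closure D)ᶜ) {r₁ R : ℝ} (hr₁ : r₁ < R) {Q : Set ((E3 → E3) × ℝ≥0∞)}
    (hQ : ∀ p ∈ Q, MemH1 (truncation D R) p.1 ∧ gradSum (truncation D R) p.1 ≤ p.2)
    (hDR : closure D ⊆ Metric.ball 0 R)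
    (hann : ∀ x, r₁ < ‖x‖ → LocalBound (truncation D R) Q x) :
    ∀ x ∈ closure (truncation D R), LocalBound (truncation D R) Q x := by
  have hext := localBound_exterior hD_ext hr₁ hQ hDR hann
  intro p hp
  by_cases hpD : p ∈ closure D
  swap
  · exact hext hpD
  have hpf : p ∈ frontier D := by
    refine ⟨hpD, fun hpi => ?_⟩
    rw [hD_open.interior_eq] at hpi
    obtain ⟨y, hy, hyU⟩ := mem_closure_iff.1 hp D hD_open hpi
    exact hyU.2 (subset_closure hy)
  obtain ⟨e, r, f, hr, he, hfs, hfp, hcl⟩ := hD_lip.exists_chart hpf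
  obtain ⟨s, hs, hsR⟩ := Metric.isOpen_iff.1 Metric.isOpen_ball p (hDR hpD)
  -- Half the minimum, so that points within `δ` of `p`, moved by at most `δ`, stay both in the
  -- chart and in the ball of radius `R`.
  set δ := min r s / 2 with hδ
  have hδ0 : 0 < δ := by positivity
  have hδr : δ + δ ≤ r := by rw [hδ]; linarith [min_le_left r s]
  have hδs : δ + δ ≤ s := by rw [hδ]; linarith [min_le_right r s]
  have hstep : ∀ x ∈ Metric.ball p δ, ∀ t ∈ Set.Icc (0 : ℝ) 1,
      x + t • (-(δ / 2) • e) ∈ Metric.ball p (δ + δ) ∧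
      x + t • (-(δ / 2) • e) = x - (t * (δ / 2)) • e := by
    intro x hx t ht
    have heq : x + t • (-(δ / 2) • e) = x - (t * (δ / 2)) • e := by module
    refine ⟨?_, heq⟩
    rw [heq, Metric.mem_ball, dist_eq_norm]
    have h1 : ‖x - p‖ < δ := by rw [← dist_eq_norm]; exact hx
    calc ‖x - (t * (δ / 2)) • e - p‖ = ‖(x - p) - (t * (δ / 2)) • e‖ := by congr 1; abel
      _ ≤ ‖x - p‖ + ‖(t * (δ / 2)) • e‖ := norm_sub_le _ _
      _ ≤ ‖x - p‖ + δ := by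
        rw [norm_smul, he, mul_one, Real.norm_of_nonneg (by have := ht.1; positivity)]
        have := mul_le_mul_of_nonneg_right ht.2 (by positivity : 0 ≤ δ / 2)
        linarith
      _ < _ := by linarith
  refine LocalBound.of_shift (isOpen_truncation D R) (isBounded_truncation D R) hQ
    (h := -(δ / 2) • e) hδ0 ?_ (hext ?_)
  · rintro x ⟨hxp, hxU⟩ t ht
    obtain ⟨h1, h2⟩ := hstep x hxp t ht
    refine ⟨hsR (Metric.ball_subset_ball hδs h1), ?_⟩
    rw [hcl _ (Metric.ball_subset_ball hδr h1), h2, hfs]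
    have h3 := (hcl x (Metric.ball_subset_ball (by linarith) hxp)).not.1 hxU.2
    have : 0 ≤ t * (δ / 2) := mul_nonneg ht.1 (by positivity)
    linarith
  · obtain ⟨h1, h2⟩ := hstep p (Metric.mem_ball_self hδ0) 1 ⟨zero_le_one, le_rfl⟩
    rw [one_smul] at h1 h2
    rw [Set.mem_compl_iff, hcl _ (Metric.ball_subset_ball hδr h1), h2, hfs]
    linarith

/-! ### Radial comparison between a shell and the outer sphere. -/

/-- The open spherical shell `{x : r < |x| < R}`. -/
def shell (r R : ℝ) : Set E3 := {x | r < ‖x‖ ∧ ‖x‖ < R}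

theorem isOpen_shell (r R : ℝ) : IsOpen (shell r R) :=
  (isOpen_lt continuous_const continuous_norm).inter (isOpen_lt continuous_norm continuous_const)

theorem shell_subset_truncation {D : Set E3} {r R : ℝ} (hD : closure D ⊆ Metric.ball 0 r) :
    shell r R ⊆ truncation D R := fun x hx => by
  refine ⟨by simpa using hx.2, fun h => ?_⟩
  have := hD h
  rw [mem_ball_zero_iff] at this
  exact lt_asymm this hx.1

/-- `v` is continuous up to the sphere of radius `R`. -/
def ContinuousNearSphere (R : ℝ) (v : E3 → E3) : Prop :=
  ∃ r < R, ContinuousOn v (Metric.closedBall 0 R \ Metric.closedBall 0 r)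

theorem ContinuousNearSphere.sub {R : ℝ} {v w : E3 → E3} (hv : ContinuousNearSphere R v)
    (hw : ContinuousNearSphere R w) : ContinuousNearSphere R (v - w) := by
  obtain ⟨r, hr, h⟩ := hv
  obtain ⟨s, hs, h'⟩ := hw
  refine ⟨max r s, max_lt hr hs, (h.mono ?_).sub (h'.mono ?_)⟩
  · exact Set.sdiff_subset_sdiff_right (Metric.closedBall_subset_closedBall (le_max_left _ _))
  · exact Set.sdiff_subset_sdiff_right (Metric.closedBall_subset_closedBall (le_max_right _ _))

theorem ContinuousNearSphere.continuousOn_sphere {R : ℝ} {v : E3 → E3}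
    (hv : ContinuousNearSphere R v) : ContinuousOn v (Metric.sphere 0 R) := by
  obtain ⟨r, hr, h⟩ := hv
  refine h.mono fun x hx => ?_
  rw [mem_sphere_zero_iff_norm] at hx
  simp [hx, hr]

theorem ContinuousNearSphere.continuous_unitSphere {R : ℝ} (hR : 0 < R) {v : E3 → E3}
    (hv : ContinuousNearSphere R v) :
    Continuous fun θ : Metric.sphere (0 : E3) 1 => v (R • (θ : E3)) := by
  refine hv.continuousOn_sphere.comp_continuous (by fun_prop) fun θ => ?_
  simp [norm_smul, abs_of_pos hR]

theorem exists_rat_seq {a b : ℝ} (hab : a < b) :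
    ∃ q : ℕ → ℚ, (∀ n, a < q n ∧ (q n : ℝ) < b) ∧ Tendsto (fun n => (q n : ℝ)) atTop (𝓝 b) := by
  have h1 (n : ℕ) : max a (b - 1 / ((n : ℝ) + 1)) < b :=
    max_lt hab (sub_lt_self _ (by positivity))
  choose q hq using fun n => exists_rat_btwn (h1 n)
  refine ⟨q, fun n => ⟨(le_max_left _ _).trans_lt (hq n).1, (hq n).2⟩, ?_⟩
  have h2 : Tendsto (fun n : ℕ => b - 1 / ((n : ℝ) + 1)) atTop (𝓝 b) := by
    simpa using tendsto_one_div_add_atTop_nhds_zero_nat.const_sub b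
  exact tendsto_of_tendsto_of_tendsto_of_le_of_le h2 tendsto_const_nhds
    (fun n => (le_max_right _ _).trans (hq n).1.le) fun n => (hq n).2.le

/-- The segment formula with `c = 0`, `m = 1`. Extending the time integral to `R / r - 1` makes the
right side independent of `T`, ready for a limit in `T`. -/
theorem MemH1.ae_enorm_dilation_sub_le {D : Set E3} {r R : ℝ} (hr : 0 < r)
    (hD : closure D ⊆ Metric.ball 0 r) {v : E3 → E3} (hv : MemH1 (truncation D R) v) {T : ℝ}
    (hT : 0 ≤ T) :
    ∀ᵐ x, r < ‖x‖ → (1 + T) * ‖x‖ < R → ‖v ((1 + T) • x) - v x‖ₑ ≤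
      ‖x‖ₑ * ∫⁻ t in Set.Ioc 0 (R / r - 1),
        gradPt (truncation D R) v (x + t • ((0 : E3) + (1 : ℝ) • x)) := by
  set U := truncation D R
  have hb : Bornology.IsBounded U := isBounded_truncation D R
  have key := ae_sub_eq_integral_flow (isOpen_truncation D R)
    (A := {x : E3 | r < ‖x‖ ∧ (1 + T) * ‖x‖ < R})
    ((isOpen_lt continuous_const continuous_norm).inter
      (isOpen_lt (continuous_const.mul continuous_norm) continuous_const))
    (integrableOn_of_memLp_two hb hv.1)
    (fun j => integrableOn_of_memLp_two hb (hv.memLp_weakPartial j)) hv.hasWeakPartial 0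
    (zero_le_one (α := ℝ)) hT ?_
  swap
  · rintro x ⟨hx1, hx2⟩ t ht
    apply shell_subset_truncation hD
    have : x + t • ((0 : E3) + (1 : ℝ) • x) = (1 + t) • x := by module
    have h1 : 0 ≤ 1 + t := by linarith [ht.1]
    rw [this]
    refine ⟨?_, ?_⟩
    · rw [norm_smul, Real.norm_of_nonneg h1]
      nlinarith [ht.1, norm_nonneg x]
    · rw [norm_smul, Real.norm_of_nonneg h1]
      nlinarith [ht.2, norm_nonneg x]
  filter_upwards [key] with x hx hx1 hx2
  have h1 := hx ⟨hx1, hx2⟩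
  rw [show x + T • ((0 : E3) + (1 : ℝ) • x) = (1 + T) • x by module] at h1
  have hTT : T ≤ R / r - 1 := by
    rw [le_sub_iff_add_le, le_div_iff₀ hr]
    nlinarith
  rw [h1]
  calc _ ≤ ∫⁻ t in Set.Ioc 0 T, ‖x‖ₑ * gradPt U v (x + t • ((0 : E3) + (1 : ℝ) • x)) := by
        refine (enorm_integral_le_lintegral_enorm _).trans (lintegral_mono fun t => ?_)
        have := enorm_sum_smul_le x U v (x + t • ((0 : E3) + (1 : ℝ) • x))
        simpa only [zero_add, one_smul] using this
    _ = ‖x‖ₑ * ∫⁻ t in Set.Ioc 0 T, gradPt U v (x + t • ((0 : E3) + (1 : ℝ) • x)) :=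
        lintegral_const_mul' _ _ enorm_ne_top
    _ ≤ _ := by
        gcongr

/-- The dilation factor now depends on `x`, whereas the null set depends on the factor. Rational
factors share one null set, and continuity of `v` up to the sphere gives the limit factor `R / ‖x‖`.
-/
theorem MemH1.ae_enorm_radial_sub_le {D : Set E3} {r R : ℝ} (hr : 0 < r)
    (hD : closure D ⊆ Metric.ball 0 r) {v : E3 → E3} (hv : MemH1 (truncation D R) v)
    (hvc : ContinuousNearSphere R v) :
    ∀ᵐ x, x ∈ shell r R → ‖v ((R / ‖x‖) • x) - v x‖ₑ ≤
      ‖x‖ₑ * ∫⁻ t in Set.Ioc 0 (R / r - 1),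
        gradPt (truncation D R) v (x + t • ((0 : E3) + (1 : ℝ) • x)) := by
  have hall : ∀ᵐ x, ∀ q : ℚ, 0 ≤ (q : ℝ) → r < ‖x‖ → (1 + (q : ℝ)) * ‖x‖ < R →
      ‖v ((1 + (q : ℝ)) • x) - v x‖ₑ ≤ ‖x‖ₑ * ∫⁻ t in Set.Ioc 0 (R / r - 1),
        gradPt (truncation D R) v (x + t • ((0 : E3) + (1 : ℝ) • x)) := by
    refine ae_all_iff.2 fun q => ?_
    by_cases hq : 0 ≤ (q : ℝ)
    · filter_upwards [hv.ae_enorm_dilation_sub_le hr hD hq] with x hx _ using hx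
    · exact Eventually.of_forall fun x h => absurd h hq
  filter_upwards [hall] with x hx ⟨hx1, hx2⟩
  have hx0 : 0 < ‖x‖ := hr.trans hx1
  have h0 : 0 < R / ‖x‖ - 1 := by
    rw [sub_pos, one_lt_div hx0]
    exact hx2
  obtain ⟨q, hq, hlim⟩ := exists_rat_seq h0
  obtain ⟨s, hs, hcont⟩ := hvc
  have hn : ∀ a : ℝ, 0 ≤ a → ‖a • x‖ = a * ‖x‖ := fun a ha => by
    rw [norm_smul, Real.norm_of_nonneg ha]
  have hR : R / ‖x‖ * ‖x‖ = R := div_mul_cancel₀ _ hx0.ne'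
  have hqR : ∀ n, (1 + (q n : ℝ)) * ‖x‖ < R := fun n => by
    rw [← hR]
    exact mul_lt_mul_of_pos_right (by linarith [(hq n).2]) hx0
  have hpt : Tendsto (fun n => (1 + (q n : ℝ)) • x) atTop (𝓝 ((R / ‖x‖) • x)) := by
    have := (hlim.const_add 1).smul_const x
    simpa using this
  have hnorm : ‖(R / ‖x‖) • x‖ = R := by rw [hn _ (by linarith), hR]
  have hmem : (R / ‖x‖) • x ∈ Metric.closedBall (0 : E3) R \ Metric.closedBall 0 s := by
    simp only [Set.mem_sdiff, mem_closedBall_zero_iff, hnorm]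
    exact ⟨le_rfl, not_le.2 hs⟩
  have hev : ∀ᶠ n in atTop, (1 + (q n : ℝ)) • x ∈
      Metric.closedBall (0 : E3) R \ Metric.closedBall 0 s := by
    have h1 : ∀ᶠ n in atTop, s < ‖(1 + (q n : ℝ)) • x‖ :=
      hpt.norm.eventually (lt_mem_nhds (by rwa [hnorm]))
    filter_upwards [h1] with n hn1
    simp only [Set.mem_sdiff, mem_closedBall_zero_iff]
    refine ⟨?_, not_le.2 hn1⟩
    rw [hn _ (by linarith [(hq n).1])]
    exact (hqR n).le
  have hvl : Tendsto (fun n => v ((1 + (q n : ℝ)) • x)) atTop (𝓝 (v ((R / ‖x‖) • x))) :=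
    (hcont _ hmem).tendsto.comp (tendsto_nhdsWithin_iff.2 ⟨hpt, hev⟩)
  exact le_of_tendsto (hvl.sub_const (v x)).enorm
    (Eventually.of_forall fun n => hx (q n) (hq n).1.le hx1 (hqR n))

theorem MemH1.eLpNorm_radial_sub_le {D : Set E3} {r R : ℝ} (hr : 0 < r)
    (hD : closure D ⊆ Metric.ball 0 r) {v : E3 → E3} (hv : MemH1 (truncation D R) v)
    (hvc : ContinuousNearSphere R v) :
    eLpNorm (fun x => v ((R / ‖x‖) • x) - v x) 2 (volume.restrict (shell r R)) ≤
      (ENNReal.ofReal R * ENNReal.ofReal (R / r - 1)) * gradSum (truncation D R) v := by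
  rw [eLpNorm_two_le_iff]
  calc _ ≤ ∫⁻ x in shell r R, (ENNReal.ofReal R * ∫⁻ t in Set.Ioc 0 (R / r - 1),
        gradPt (truncation D R) v (x + t • ((0 : E3) + (1 : ℝ) • x))) ^ 2 := by
        refine lintegral_mono_ae ?_
        rw [ae_restrict_iff' (isOpen_shell r R).measurableSet]
        filter_upwards [hv.ae_enorm_radial_sub_le hr hD hvc] with x hx hxs
        gcongr
        refine (hx hxs).trans ?_
        gcongr
        rw [← ofReal_norm]
        exact ENNReal.ofReal_le_ofReal hxs.2.le
    _ ≤ ∫⁻ x, (ENNReal.ofReal R * ∫⁻ t in Set.Ioc 0 (R / r - 1),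
        gradPt (truncation D R) v (x + t • ((0 : E3) + (1 : ℝ) • x))) ^ 2 :=
        setLIntegral_le_lintegral _ _
    _ ≤ ENNReal.ofReal R ^ 2 * (ENNReal.ofReal (R / r - 1) ^ 2 *
        ∫⁻ x, gradPt (truncation D R) v x ^ 2) := by
        simp only [mul_pow]
        rw [lintegral_const_mul' _ _ (by simp)]
        gcongr
        exact lintegral_sq_flow_le (hv.aemeasurable_gradPt (isOpen_truncation D R)) 0 zero_le_one
    _ ≤ _ := by
        rw [mul_pow, mul_pow, mul_assoc]
        gcongr
        exact hv.lintegral_sq_gradPt_le (isOpen_truncation D R)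

theorem measurableEmbedding_sphere {R : ℝ} (hR : 0 < R) :
    MeasurableEmbedding fun θ : Metric.sphere (0 : E3) 1 => R • (θ : E3) :=
  (Homeomorph.smulOfNeZero (α := E3) R hR.ne').measurableEmbedding.comp
    (MeasurableEmbedding.subtype_coe Metric.isClosed_sphere.measurableSet)

theorem lintegral_surfaceMeasure {R : ℝ} (hR : 0 < R) (f : E3 → ℝ≥0∞) :
    ∫⁻ x, f x ∂(surfaceMeasure R) =
      ENNReal.ofReal (R ^ 2) * ∫⁻ θ, f (R • (θ : E3)) ∂(volume : Measure E3).toSphere := by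
  rw [surfaceMeasure, lintegral_smul_measure, (measurableEmbedding_sphere hR).lintegral_map]
  rfl

/-- Polar coordinates for an integrand constant along rays: the radial integral factors out. The
constant is written as a square so that `L²` norms scale by `κ`. -/
theorem exists_polar {r R : ℝ} (hr : 0 < r) (hrR : r < R) :
    ∃ κ : ℝ≥0∞, κ ≠ 0 ∧ κ ≠ ⊤ ∧ ∀ f : E3 → ℝ≥0∞,
      AEMeasurable (fun θ : Metric.sphere (0 : E3) 1 => f (R • (θ : E3)))
        (volume : Measure E3).toSphere →
      ∫⁻ x in shell r R, f ((R / ‖x‖) • x) = κ ^ 2 * ∫⁻ x, f x ∂(surfaceMeasure R) := by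
  have hR : 0 < R := hr.trans hrR
  set ν := Measure.volumeIoiPow (Module.finrank ℝ E3 - 1) with hν
  set I : Set (Set.Ioi (0 : ℝ)) := {s | r < s.1 ∧ s.1 < R} with hI
  have hIm : MeasurableSet I := by
    apply MeasurableSet.inter
    · exact measurableSet_lt measurable_const measurable_subtype_coe
    · exact measurableSet_lt measurable_subtype_coe measurable_const
  have key : ∀ f : E3 → ℝ≥0∞,
      AEMeasurable (fun θ : Metric.sphere (0 : E3) 1 => f (R • (θ : E3)))
        (volume : Measure E3).toSphere →
      ∫⁻ x in shell r R, f ((R / ‖x‖) • x) =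
        ν I * ∫⁻ θ, f (R • (θ : E3)) ∂(volume : Measure E3).toSphere := by
    intro f hf
    have hmp := (volume : Measure E3).measurePreserving_homeomorphUnitSphereProd
    have h1 : ∫⁻ x in shell r R, f ((R / ‖x‖) • x) =
        ∫⁻ x : ({0}ᶜ : Set E3), (shell r R).indicator (fun x => f ((R / ‖x‖) • x)) x
          ∂(Measure.comap Subtype.val volume) := by
      rw [← lintegral_indicator (isOpen_shell r R).measurableSet,
        lintegral_subtype_comap (measurableSet_singleton _).compl]
      rw [← restrict_compl_singleton (μ := (volume : Measure E3)) (0 : E3)]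
      simp
    have h2 : ∀ x : ({0}ᶜ : Set E3), (shell r R).indicator (fun x => f ((R / ‖x‖) • x)) (x : E3) =
        (fun p : Metric.sphere (0 : E3) 1 × Set.Ioi (0 : ℝ) =>
          f (R • (p.1 : E3)) * I.indicator 1 p.2) (homeomorphUnitSphereProd E3 x) := by
      intro x
      by_cases hx : (x : E3) ∈ shell r R
      · have hx' : (homeomorphUnitSphereProd E3 x).2 ∈ I := by
          simpa [hI, homeomorphUnitSphereProd, shell] using hx
        simp [hx, hx', smul_smul, div_eq_mul_inv]
      · have hx' : (homeomorphUnitSphereProd E3 x).2 ∉ I := by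
          simpa [hI, homeomorphUnitSphereProd, shell] using hx
        simp [hx, hx']
    have h3 := hmp.lintegral_comp_emb (homeomorphUnitSphereProd E3).measurableEmbedding
      fun p => f (R • (p.1 : E3)) * I.indicator 1 p.2
    rw [h1, lintegral_congr h2, h3,
      lintegral_prod_mul hf ((measurable_one.indicator hIm).aemeasurable),
      lintegral_indicator_one hIm, mul_comm]
  have hfin : ν I ≠ ⊤ := by
    have hsub : I ⊆ Set.Iio ⟨R, hR⟩ := fun s hs => Set.mem_Iio.2 (Subtype.coe_lt_coe.1 hs.2)
    refine ne_top_of_le_ne_top ?_ (measure_mono hsub)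
    rw [hν, Measure.volumeIoiPow_apply_Iio]
    exact ENNReal.ofReal_ne_top
  have hpos : ν I ≠ 0 := by
    intro h0
    -- With `f = 1`, vanishing radial mass would make the volume of the nonempty open shell zero.
    have := key (fun _ => 1) aemeasurable_const
    rw [h0, zero_mul, setLIntegral_one] at this
    refine (isOpen_shell r R).measure_ne_zero volume ?_ this
    have hx : ‖(EuclideanSpace.single 0 ((r + R) / 2) : E3)‖ = (r + R) / 2 := by
      rw [PiLp.norm_single, Real.norm_of_nonneg (by linarith)]
    exact ⟨_, by rw [hx]; linarith, by rw [hx]; linarith⟩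
  have hR2 : ENNReal.ofReal (R ^ 2) ≠ 0 := by
    rw [Ne, ENNReal.ofReal_eq_zero, not_le]
    positivity
  refine ⟨(ν I / ENNReal.ofReal (R ^ 2)) ^ (1 / 2 : ℝ), ?_, ?_, fun f hf => ?_⟩
  · rw [Ne, ENNReal.rpow_eq_zero_iff_of_pos (by norm_num), ENNReal.div_eq_zero_iff]
    simp [hpos]
  · exact ENNReal.rpow_ne_top_of_nonneg (by norm_num) (ENNReal.div_ne_top hfin hR2)
  · rw [key f hf, lintegral_surfaceMeasure hR, ← ENNReal.rpow_natCast, ← ENNReal.rpow_mul,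
      ← mul_assoc]
    norm_num
    rw [ENNReal.div_mul_cancel hR2 ENNReal.ofReal_ne_top]

theorem ContinuousNearSphere.aestronglyMeasurable {R : ℝ} (hR : 0 < R) {v : E3 → E3}
    (hv : ContinuousNearSphere R v) : AEStronglyMeasurable v (surfaceMeasure R) := by
  refine AEStronglyMeasurable.smul_measure ?_ _
  rw [(measurableEmbedding_sphere hR).aestronglyMeasurable_map_iff]
  exact (hv.continuous_unitSphere hR).aestronglyMeasurable

theorem isFiniteMeasure_surfaceMeasure {R : ℝ} : IsFiniteMeasure (surfaceMeasure R) := by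
  unfold surfaceMeasure
  exact Measure.smul_finite _ ENNReal.ofReal_ne_top

theorem ContinuousNearSphere.memLp {R : ℝ} (hR : 0 < R) {v : E3 → E3}
    (hv : ContinuousNearSphere R v) : MemLp v 2 (surfaceMeasure R) := by
  obtain ⟨C, hC⟩ := (isCompact_sphere (0 : E3) R).exists_bound_of_continuousOn
    hv.continuousOn_sphere
  have := isFiniteMeasure_surfaceMeasure (R := R)
  refine MemLp.of_bound (hv.aestronglyMeasurable hR) C ?_
  refine Measure.ae_smul_measure ?_ _
  rw [(measurableEmbedding_sphere hR).ae_map_iff]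
  refine Eventually.of_forall fun θ => hC _ ?_
  simp [norm_smul, abs_of_pos hR]

theorem ContinuousNearSphere.aestronglyMeasurable_radial {r R : ℝ} (hr : 0 < r) {v : E3 → E3}
    (hv : ContinuousNearSphere R v) :
    AEStronglyMeasurable (fun x => v ((R / ‖x‖) • x)) (volume.restrict (shell r R)) := by
  refine ContinuousOn.aestronglyMeasurable ?_ (isOpen_shell r R).measurableSet
  have hne : ∀ x ∈ shell r R, ‖x‖ ≠ 0 := fun x hx => (hr.trans hx.1).ne'
  refine hv.continuousOn_sphere.comp ?_ fun x hx => ?_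
  · exact (continuousOn_const.div continuousOn_id.norm hne).smul continuousOn_id
  · have h0 : 0 < ‖x‖ := hr.trans hx.1
    rw [mem_sphere_zero_iff_norm, norm_smul,
      Real.norm_of_nonneg (div_nonneg (h0.trans hx.2).le h0.le), div_mul_cancel₀ _ h0.ne']

/-- The radial extension of the boundary values has shell norm `κ` times the sphere norm, and
differs from `v` by the gradient. Reading this comparison in the two directions gives the Poincaré
bound in the shell and the trace inequality. -/
theorem exists_shell_and_trace_bound {D : Set E3} {r R : ℝ} (hr : 0 < r) (hrR : r < R)
    (hD : closure D ⊆ Metric.ball 0 r) : ∃ C : ℝ≥0, ∀ v : E3 → E3,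
    MemH1 (truncation D R) v → ContinuousNearSphere R v →
      eLpNorm v 2 (volume.restrict (shell r R)) ≤
        C * (gradSum (truncation D R) v + eLpNorm v 2 (surfaceMeasure R)) ∧
      eLpNorm v 2 (surfaceMeasure R) ≤
        C * (gradSum (truncation D R) v + eLpNorm v 2 (volume.restrict (truncation D R))) := by
  have hR : 0 < R := hr.trans hrR
  obtain ⟨κ, hκ0, hκt, hκ⟩ := exists_polar hr hrR
  set K : ℝ≥0∞ := ENNReal.ofReal R * ENNReal.ofReal (R / r - 1) with hK
  have hKt : K ≠ ⊤ := ENNReal.mul_ne_top ENNReal.ofReal_ne_top ENNReal.ofReal_ne_top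
  set C : ℝ≥0∞ := K + κ + κ⁻¹ * (K + 1) with hC
  have hCt : C ≠ ⊤ := ENNReal.add_ne_top.2 ⟨ENNReal.add_ne_top.2 ⟨hKt, hκt⟩,
    ENNReal.mul_ne_top (ENNReal.inv_ne_top.2 hκ0) (ENNReal.add_ne_top.2 ⟨hKt, ENNReal.one_ne_top⟩)⟩
  refine ⟨C.toNNReal, fun v hv hvc => ?_⟩
  rw [ENNReal.coe_toNNReal hCt]
  have hpol : eLpNorm (fun x => v ((R / ‖x‖) • x)) 2 (volume.restrict (shell r R)) =
      κ * eLpNorm v 2 (surfaceMeasure R) := by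
    have h1 := hκ (fun y => ‖v y‖ₑ ^ 2)
      ((hvc.continuous_unitSphere hR).enorm.measurable.pow_const 2).aemeasurable
    rw [← sq_eLpNorm_two v, ← mul_pow,
      ← sq_eLpNorm_two (fun x => v ((R / ‖x‖) • x))] at h1
    exact le_antisymm ((ENNReal.pow_le_pow_left_iff two_ne_zero).1 h1.le)
      ((ENNReal.pow_le_pow_left_iff two_ne_zero).1 h1.ge)
  have hsub := hv.eLpNorm_radial_sub_le hr hD hvc
  have hm1 := hvc.aestronglyMeasurable_radial hr
  have hm2 : AEStronglyMeasurable v (volume.restrict (shell r R)) :=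
    hv.1.1.mono_measure (Measure.restrict_mono_set _ (shell_subset_truncation hD))
  constructor
  · calc eLpNorm v 2 (volume.restrict (shell r R))
        = eLpNorm ((fun x => v ((R / ‖x‖) • x)) - fun x => v ((R / ‖x‖) • x) - v x) 2
          (volume.restrict (shell r R)) := by
          congr 1
          ext1 x
          simp
      _ ≤ _ := eLpNorm_sub_le hm1 (hm1.sub hm2) (by norm_num)
      _ ≤ κ * eLpNorm v 2 (surfaceMeasure R) + K * gradSum (truncation D R) v :=
          add_le_add hpol.le hsub
      _ ≤ C * eLpNorm v 2 (surfaceMeasure R) + C * gradSum (truncation D R) v := by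
          gcongr
          · exact (le_add_self).trans le_self_add
          · exact le_self_add.trans le_self_add
      _ = _ := by ring
  · have h1 : κ * eLpNorm v 2 (surfaceMeasure R) ≤ (K + 1) * (gradSum (truncation D R) v +
        eLpNorm v 2 (volume.restrict (truncation D R))) := by
      rw [← hpol]
      calc _ = eLpNorm ((fun x => v ((R / ‖x‖) • x) - v x) + v) 2
            (volume.restrict (shell r R)) := by
            congr 1
            ext1 x
            simp
        _ ≤ _ := eLpNorm_add_le (hm1.sub hm2) hm2 (by norm_num)
        _ ≤ K * gradSum (truncation D R) v +
            eLpNorm v 2 (volume.restrict (truncation D R)) :=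
          add_le_add hsub (eLpNorm_restrict_mono _ (shell_subset_truncation hD))
        _ ≤ (K + 1) * gradSum (truncation D R) v +
            (K + 1) * eLpNorm v 2 (volume.restrict (truncation D R)) := by
          gcongr
          · exact le_self_add
          · exact le_mul_of_one_le_left' le_add_self
        _ = _ := by ring
    calc eLpNorm v 2 (surfaceMeasure R) = κ⁻¹ * (κ * eLpNorm v 2 (surfaceMeasure R)) := by
          rw [← mul_assoc, ENNReal.inv_mul_cancel hκ0 hκt, one_mul]
      _ ≤ κ⁻¹ * ((K + 1) * (gradSum (truncation D R) v +
        eLpNorm v 2 (volume.restrict (truncation D R)))) := by gcongr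
      _ ≤ _ := by
        rw [← mul_assoc]
        gcongr
        exact le_add_self

/-! ### Approximation by functions continuous up to the sphere. -/

/-- A smooth bump function supported in the closed unit ball. -/
noncomputable def unitBump : ContDiffBump (0 : E3) := ⟨1 / 2, 1, by norm_num, by norm_num⟩

/-- A continuous probability density supported in the closed unit ball. -/
noncomputable def kernel : E3 → ℝ := unitBump.normed volume

theorem continuous_kernel : Continuous kernel := unitBump.continuous_normed

theorem hasCompactSupport_kernel : HasCompactSupport kernel := unitBump.hasCompactSupport_normed

theorem integral_kernel : ∫ y, kernel y = 1 := unitBump.integral_normed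

theorem integrable_kernel : Integrable kernel := unitBump.integrable_normed

theorem kernel_nonneg (y : E3) : 0 ≤ kernel y := unitBump.nonneg_normed y

theorem kernel_eq_zero {y : E3} (hy : 1 < ‖y‖) : kernel y = 0 := by
  have : y ∉ Function.support kernel := by
    rw [kernel, ContDiffBump.support_normed_eq]
    simpa [unitBump] using hy.le
  simpa using this

theorem lintegral_enorm_kernel : ∫⁻ y, ‖kernel y‖ₑ = 1 := by
  rw [← ofReal_integral_norm_eq_lintegral_enorm integrable_kernel]
  simp [Real.norm_of_nonneg (kernel_nonneg _), integral_kernel]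

/-- Dilated mollification: an average of `f` near `(1 - s) • x`, at scale `s * R`. -/
noncomputable def dilAvg (R s : ℝ) (f : E3 → E3) (x : E3) : E3 :=
  ∫ y, kernel y • f ((1 - s) • x + (s * R) • y)

theorem quasiMeasurePreserving_affine_prod (a : ℝ) {b : ℝ} (hb : 0 < b) :
    Measure.QuasiMeasurePreserving (fun p : E3 × E3 => a • p.1 + b • p.2)
      ((volume : Measure E3).prod volume) volume := by
  have hmeas : Measurable fun p : E3 × E3 => a • p.1 + b • p.2 := by fun_prop
  refine ⟨hmeas, Measure.AbsolutelyContinuous.mk fun N hN h0 => ?_⟩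
  rw [Measure.map_apply hmeas hN, Measure.measure_prod_null (hmeas hN)]
  refine Eventually.of_forall fun x => ?_
  have : Prod.mk x ⁻¹' ((fun p : E3 × E3 => a • p.1 + b • p.2) ⁻¹' N)
      = (fun y => b • y + a • x) ⁻¹' N := by
    ext y
    simp only [Set.mem_preimage, add_comm]
  simp only [Pi.zero_apply]
  rw [this, ← Measure.map_apply (by fun_prop) hN, map_affine_volume hb]
  simp [h0]

theorem integrable_kernel_smul_affine {f : E3 → E3} (hf : Integrable f) {b : ℝ} (hb : 0 < b)
    (z : E3) : Integrable fun y => kernel y • f (z + b • y) := by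
  refine integrable_test_smul ?_ continuous_kernel hasCompactSupport_kernel
  simpa only [add_comm] using integrable_comp_affine hf hb z

/-- A change of variables puts the dependence on `x` into the continuous kernel, and dominated
convergence applies. -/
theorem continuous_dilAvg {R s : ℝ} (hb : 0 < s * R) {f : E3 → E3} (hf : Integrable f) :
    Continuous (dilAvg R s f) := by
  set b := s * R
  have h1 : ∀ x, dilAvg R s f x =
      (b ^ 3)⁻¹ • ∫ z, kernel (b⁻¹ • (z - (1 - s) • x)) • f z := by
    intro x
    rw [← integral_comp_affine (fun z => kernel (b⁻¹ • (z - (1 - s) • x)) • f z) hb ((1 - s) • x)]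
    simp only [add_sub_cancel_right, smul_smul, inv_mul_cancel₀ hb.ne', one_smul]
    simp only [dilAvg, add_comm]
    rfl
  obtain ⟨C, hC⟩ := hasCompactSupport_kernel.exists_bound_of_continuous continuous_kernel
  rw [funext h1]
  suffices Continuous fun x => ∫ z, kernel (b⁻¹ • (z - (1 - s) • x)) • f z from
    this.const_smul ((b ^ 3)⁻¹)
  have hc (x : E3) : Continuous fun z : E3 => kernel (b⁻¹ • (z - (1 - s) • x)) :=
    continuous_kernel.comp (by fun_prop)
  have hc' (z : E3) : Continuous fun x : E3 => kernel (b⁻¹ • (z - (1 - s) • x)) :=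
    continuous_kernel.comp (by fun_prop)
  refine continuous_of_dominated (bound := fun z => C * ‖f z‖) (fun x => ?_) (fun x => ?_)
    (hf.norm.const_mul C) ?_
  · exact (hc x).aestronglyMeasurable.smul hf.aestronglyMeasurable
  · refine Eventually.of_forall fun z => ?_
    rw [norm_smul]
    gcongr
    exact hC _
  · refine Eventually.of_forall fun z => ?_
    exact (hc' z).smul continuous_const

/-- Jensen's inequality for the probability density `kernel`, obtained from `sq_lintegral_le` with
total mass `1`, followed by Tonelli. -/
theorem eLpNorm_dilAvg_sub_le {R s : ℝ} (hb : 0 < s * R) {f : E3 → E3} (hf : Integrable f)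
    {δ : ℝ≥0∞} {B : Set E3}
    (hδ : ∀ y : E3, ‖y‖ ≤ 1 →
      eLpNorm (fun x => f ((1 - s) • x + (s * R) • y) - f x) 2 (volume.restrict B) ≤ δ) :
    eLpNorm (dilAvg R s f - f) 2 (volume.restrict B) ≤ δ := by
  set b := s * R
  set h : E3 → E3 → ℝ≥0∞ := fun x y => ‖f ((1 - s) • x + b • y) - f x‖ₑ with hh
  have hmeas : AEMeasurable (Function.uncurry h) ((volume : Measure E3).prod volume) := by
    refine AEStronglyMeasurable.enorm (AEStronglyMeasurable.sub ?_ ?_)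
    · exact hf.aestronglyMeasurable.comp_quasiMeasurePreserving
        (quasiMeasurePreserving_affine_prod (1 - s) hb)
    · exact hf.aestronglyMeasurable.comp_fst
  have hk : Measurable fun y : E3 => ‖kernel y‖ₑ := continuous_kernel.enorm.measurable
  have hfib : ∀ x, AEMeasurable (h x) := fun x => by
    have := (integrable_comp_affine hf hb ((1 - s) • x)).aestronglyMeasurable
    simp only [add_comm (b • _)] at this
    exact (this.sub aestronglyMeasurable_const).enorm
  have hpt : ∀ x, ‖(dilAvg R s f - f) x‖ₑ ^ 2 ≤ ∫⁻ y, ‖kernel y‖ₑ * h x y ^ 2 := by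
    intro x
    have h1 : (dilAvg R s f - f) x = ∫ y, kernel y • (f ((1 - s) • x + b • y) - f x) := by
      simp only [smul_sub]
      rw [integral_sub (integrable_kernel_smul_affine hf hb _) (integrable_kernel.smul_const _),
        integral_smul_const, integral_kernel, one_smul]
      rfl
    set ν := volume.withDensity fun y => ‖kernel y‖ₑ with hν
    have hac : ν ≪ volume := withDensity_absolutelyContinuous _ _
    have hνu : ν Set.univ = 1 := by
      rw [hν, withDensity_apply _ MeasurableSet.univ, Measure.restrict_univ,
        lintegral_enorm_kernel]
    have h2 : ‖(dilAvg R s f - f) x‖ₑ ≤ ∫⁻ y, h x y ∂ν := by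
      rw [h1, hν, lintegral_withDensity_eq_lintegral_mul₀ hk.aemeasurable (hfib x)]
      refine (enorm_integral_le_lintegral_enorm _).trans (lintegral_mono fun y => ?_)
      rw [enorm_smul]
      rfl
    calc _ ≤ (∫⁻ y, h x y ∂ν) ^ 2 := by gcongr
      _ ≤ ν Set.univ * ∫⁻ y, h x y ^ 2 ∂ν := sq_lintegral_le ((hfib x).mono_ac hac)
      _ = _ := by
        rw [hνu, one_mul, hν, lintegral_withDensity_eq_lintegral_mul₀ hk.aemeasurable
          ((hfib x).pow_const 2)]
        rfl
  rw [eLpNorm_two_le_iff]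
  calc _ ≤ ∫⁻ x in B, ∫⁻ y, ‖kernel y‖ₑ * h x y ^ 2 := lintegral_mono fun x => hpt x
    _ = ∫⁻ y, ∫⁻ x in B, ‖kernel y‖ₑ * h x y ^ 2 := by
        refine lintegral_lintegral_swap ?_
        have : AEMeasurable (fun p : E3 × E3 => ‖kernel p.2‖ₑ * Function.uncurry h p ^ 2)
            ((volume.restrict B).prod volume) := by
          refine AEMeasurable.mul (hk.comp measurable_snd).aemeasurable ?_
          refine (hmeas.pow_const 2).mono_ac ?_
          exact (Measure.absolutelyContinuous_of_le Measure.restrict_le_self).prod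
            Measure.AbsolutelyContinuous.rfl
        exact this
    _ ≤ ∫⁻ y, ‖kernel y‖ₑ * δ ^ 2 := by
        refine lintegral_mono fun y => ?_
        by_cases hy : 1 < ‖y‖
        · simp [kernel_eq_zero hy]
        · simp only
          rw [lintegral_const_mul' _ _ enorm_ne_top]
          gcongr
          exact eLpNorm_two_le_iff.1 (hδ y (not_lt.1 hy))
    _ = δ ^ 2 := by
        rw [lintegral_mul_const _ hk, lintegral_enorm_kernel, one_mul]

theorem eLpNorm_comp_affine_le {f : E3 → E3} {a : ℝ} (ha : 1 / 2 ≤ a) (z : E3) :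
    eLpNorm (fun x => f (a • x + z)) 2 ≤ 4 * eLpNorm f 2 := by
  rw [eLpNorm_two_le_iff, lintegral_comp_affine (fun x => ‖f x‖ₑ ^ 2) (by linarith), mul_pow,
    sq_eLpNorm_two]
  gcongr
  have h1 : (a ^ 3)⁻¹ ≤ 16 := by
    rw [inv_le_comm₀ (by positivity) (by norm_num)]
    calc (16 : ℝ)⁻¹ ≤ (1 / 2) ^ 3 := by norm_num
      _ ≤ a ^ 3 := by gcongr
  calc ENNReal.ofReal (a ^ 3)⁻¹ ≤ ENNReal.ofReal 16 := ENNReal.ofReal_le_ofReal h1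
    _ = 4 ^ 2 := by norm_num

/-- Continuity of affine motions in `L²`, through a compactly supported continuous `g` close to `f`.
The displacement is `s • (R • y - x)`, at most `2 * s * R` on the ball. The six parts of `δ` are
four for `f - g` composed with the map, one for `g`, one for `f - g`. -/
theorem eventually_eLpNorm_affine_sub_le {R : ℝ} (hR : 0 < R) {f : E3 → E3}
    (hf : MemLp f 2 volume) {δ : ℝ≥0∞} (hδ : δ ≠ 0) :
    ∀ᶠ s in 𝓝[>] (0 : ℝ), ∀ y : E3, ‖y‖ ≤ 1 →
      eLpNorm (fun x => f ((1 - s) • x + (s * R) • y) - f x) 2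
        (volume.restrict (Metric.ball 0 R)) ≤ δ := by
  set B := Metric.ball (0 : E3) R
  have hδ6 : δ / 6 ≠ 0 := by simp [ENNReal.div_eq_zero_iff, hδ]
  obtain ⟨g, hgc, hfg, hgcont, hg⟩ := hf.exists_hasCompactSupport_eLpNorm_sub_le (by norm_num) hδ6
  have hvol : (volume.restrict B) Set.univ ^ ((2 : ℝ≥0∞).toReal)⁻¹ ≠ ⊤ := by
    rw [Measure.restrict_apply_univ]
    exact ENNReal.rpow_ne_top_of_nonneg (by norm_num) Metric.isBounded_ball.measure_lt_top.ne
  obtain ⟨η, hη, hηδ⟩ := ENNReal.exists_nnreal_pos_mul_lt hvol hδ6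
  obtain ⟨d, hd, hdg⟩ := Metric.uniformContinuous_iff.1
    (hgcont.uniformContinuous_of_tendsto_cocompact hgc.is_zero_at_infty) η (by exact_mod_cast hη)
  have hev : ∀ᶠ s in 𝓝[>] (0 : ℝ), s < min (1 / 2) (d / (2 * R)) :=
    nhdsWithin_le_nhds (gt_mem_nhds (by positivity))
  filter_upwards [hev, self_mem_nhdsWithin] with s hs (hs0 : 0 < s) y hy
  have hs1 : 1 / 2 ≤ 1 - s := by linarith [(lt_min_iff.1 hs).1]
  have hs2 : s * (2 * R) < d := (lt_div_iff₀ (by positivity)).1 (lt_min_iff.1 hs).2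
  set z := (s * R) • y
  have hm : ∀ {k : E3 → E3}, AEStronglyMeasurable k volume →
      AEStronglyMeasurable (fun x => k ((1 - s) • x + z)) (volume.restrict B) := fun hk => by
    refine (AEStronglyMeasurable.comp_quasiMeasurePreserving hk ⟨by fun_prop, ?_⟩).restrict
    rw [map_affine_volume (by linarith)]
    exact Measure.smul_absolutelyContinuous
  have e1 : eLpNorm (fun x => (f - g) ((1 - s) • x + z)) 2 (volume.restrict B) ≤ 4 * (δ / 6) :=
    (eLpNorm_mono_measure _ Measure.restrict_le_self).trans
      ((eLpNorm_comp_affine_le hs1 z).trans (by gcongr))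
  have e2 : eLpNorm (fun x => g ((1 - s) • x + z) - g x) 2 (volume.restrict B) ≤ δ / 6 := by
    refine (eLpNorm_le_of_ae_bound (C := η) ?_).trans ?_
    · refine (ae_restrict_iff' Metric.isOpen_ball.measurableSet).2
        (Eventually.of_forall fun x hx => ?_)
      rw [← dist_eq_norm]
      refine (hdg ?_).le
      rw [dist_eq_norm]
      have hxR : ‖x‖ < R := by simpa [B] using hx
      calc ‖(1 - s) • x + z - x‖ = ‖s • (R • y - x)‖ := by
            congr 1
            simp only [z]
            module
        _ ≤ s * (R + R) := by
            rw [norm_smul, Real.norm_of_nonneg hs0.le]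
            gcongr
            refine (norm_sub_le _ _).trans (add_le_add ?_ hxR.le)
            rw [norm_smul, Real.norm_of_nonneg hR.le]
            exact mul_le_of_le_one_right hR.le hy
        _ < d := by linarith
    · rw [ENNReal.ofReal_coe_nnreal, mul_comm]
      exact hηδ.le
  have e3 : eLpNorm (f - g) 2 (volume.restrict B) ≤ δ / 6 :=
    (eLpNorm_mono_measure _ Measure.restrict_le_self).trans hfg
  have mfg := hf.1.sub hg.1
  calc _ = eLpNorm (((fun x => (f - g) ((1 - s) • x + z)) +
          fun x => g ((1 - s) • x + z) - g x) - (f - g)) 2 (volume.restrict B) := by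
        congr 1
        ext1 x
        simp only [Pi.sub_apply, Pi.add_apply]
        abel
    _ ≤ _ := eLpNorm_sub_le ((hm mfg).add ((hm hg.1).sub hg.1.restrict)) mfg.restrict
        (by norm_num)
    _ ≤ (4 * (δ / 6) + δ / 6) + δ / 6 := by
        refine add_le_add ((eLpNorm_add_le (hm mfg) ((hm hg.1).sub hg.1.restrict)
          (by norm_num)).trans (add_le_add e1 e2)) e3
    _ = 6 * (δ / 6) := by ring
    _ = δ := ENNReal.mul_div_cancel (by norm_num) (by norm_num)

theorem tendsto_dilAvg {R : ℝ} (hR : 0 < R) {f : E3 → E3} (hf : Integrable f)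
    (hf2 : MemLp f 2 volume) :
    Tendsto (fun s => eLpNorm (dilAvg R s f - f) 2 (volume.restrict (Metric.ball 0 R)))
      (𝓝[>] (0 : ℝ)) (𝓝 0) := by
  rw [ENNReal.tendsto_nhds_zero]
  intro δ hδ
  filter_upwards [eventually_eLpNorm_affine_sub_le hR hf2 hδ.ne', self_mem_nhdsWithin]
    with s hs (hs0 : 0 < s)
  exact eLpNorm_dilAvg_sub_le (mul_pos hs0 hR) hf hs

theorem integrable_kernel_smul_affine_prod {f : E3 → E3} (hf : Integrable f) {a b : ℝ}
    (ha : 0 < a) (hb : 0 < b) {ψ : E3 → ℝ} (hψ : Continuous ψ) (hψc : HasCompactSupport ψ) :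
    Integrable (Function.uncurry fun x y => ψ x • kernel y • f (a • x + b • y))
      ((volume : Measure E3).prod volume) := by
  have hmeas : AEStronglyMeasurable (fun p : E3 × E3 => kernel p.2 • f (a • p.1 + b • p.2))
      ((volume : Measure E3).prod volume) :=
    (continuous_kernel.comp continuous_snd).aestronglyMeasurable.smul
      (hf.aestronglyMeasurable.comp_quasiMeasurePreserving
        (quasiMeasurePreserving_affine_prod a hb))
  have hint : Integrable (fun p : E3 × E3 => kernel p.2 • f (a • p.1 + b • p.2))
      ((volume : Measure E3).prod volume) := by
    refine ⟨hmeas, ?_⟩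
    rw [hasFiniteIntegral_iff_enorm, lintegral_prod_symm _ hmeas.enorm]
    simp only [enorm_smul]
    calc _ = ∫⁻ y, ‖kernel y‖ₑ * (ENNReal.ofReal (a ^ 3)⁻¹ * ∫⁻ x, ‖f x‖ₑ) := by
          refine lintegral_congr fun y => ?_
          rw [lintegral_const_mul' _ _ enorm_ne_top,
            lintegral_comp_affine (fun x => ‖f x‖ₑ) ha]
      _ = ENNReal.ofReal (a ^ 3)⁻¹ * ∫⁻ x, ‖f x‖ₑ := by
          rw [lintegral_mul_const _ continuous_kernel.enorm.measurable, lintegral_enorm_kernel,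
            one_mul]
      _ < ⊤ := ENNReal.mul_lt_top ENNReal.ofReal_lt_top hf.2
  obtain ⟨C, hC⟩ := hψc.exists_bound_of_continuous hψ
  exact hint.bdd_smul C (φ := fun p => ψ p.1) (hψ.comp continuous_fst).aestronglyMeasurable
    (Eventually.of_forall fun p => hC _)

/-- For `‖x‖ < R` and `‖y‖ ≤ 1` the point `(1 - s) • x + (s * R) • y` stays in the ball, so values
outside are never sampled and no boundary is lost. The factor `1 - s` is the chain rule for each
fixed `y`. -/
theorem HasWeakPartial.dilAvg {R s : ℝ} (hR : 0 < R) (hs0 : 0 < s) (hs1 : s < 1) {j : Fin 3}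
    {w H : E3 → E3} (hw : IntegrableOn w (Metric.ball 0 R)) (hH : IntegrableOn H (Metric.ball 0 R))
    (h : HasWeakPartial (Metric.ball 0 R) j w H) :
    HasWeakPartial (Metric.ball 0 R) j (dilAvg R s ((Metric.ball 0 R).indicator w))
      ((1 - s) • dilAvg R s ((Metric.ball 0 R).indicator H)) := by
  intro φ hφ hφc hφB
  have hb : 0 < s * R := mul_pos hs0 hR
  have hts : tsupport (fun x => fderiv ℝ φ x (EuclideanSpace.single j 1)) ⊆ tsupport φ :=
    tsupport_fderiv_apply_subset ℝ _
  rw [setIntegral_smul_eq_integral (hts.trans hφB), setIntegral_smul_eq_integral hφB]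
  have hmeas : MeasurableSet (Metric.ball (0 : E3) R) := Metric.isOpen_ball.measurableSet
  have i1 := integrable_kernel_smul_affine_prod (hw.integrable_indicator hmeas)
    (sub_pos.2 hs1) hb (continuous_partial hφ (EuclideanSpace.single j 1))
    (hasCompactSupport_partial hφc _)
  have i2 := integrable_kernel_smul_affine_prod (hH.integrable_indicator hmeas)
    (sub_pos.2 hs1) hb hφ.continuous hφc
  have e1 : ∫ x, fderiv ℝ φ x (EuclideanSpace.single j 1) •
      TruncatedFlow.dilAvg R s ((Metric.ball 0 R).indicator w) x =
      ∫ y, ∫ x, fderiv ℝ φ x (EuclideanSpace.single j 1) • kernel y •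
        (Metric.ball 0 R).indicator w ((1 - s) • x + (s * R) • y) := by
    rw [← integral_integral_swap i1]
    simp only [TruncatedFlow.dilAvg, integral_smul]
  have e2 : ∫ x, φ x • ((1 - s) •
      TruncatedFlow.dilAvg R s ((Metric.ball 0 R).indicator H)) x =
      (1 - s) • ∫ y, ∫ x, φ x • kernel y •
        (Metric.ball 0 R).indicator H ((1 - s) • x + (s * R) • y) := by
    rw [← integral_integral_swap i2, ← integral_smul]
    simp only [TruncatedFlow.dilAvg, integral_smul, Pi.smul_apply, smul_comm (φ _) (1 - s)]
  rw [e1, e2, ← smul_neg, ← integral_neg, ← integral_smul]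
  refine integral_congr_ae (Eventually.of_forall fun y => ?_)
  simp only [smul_comm _ (kernel y), integral_smul]
  by_cases hy : 1 < ‖y‖
  · simp [kernel_eq_zero hy]
  have hp : 0 < 1 + (1 : ℝ) * (-s) := by linarith
  have key := h.integral_partial_smul_comp_flow Metric.isOpen_ball ((s * R) • y) hp hφ hφc ?_
  · have hfl : ∀ x : E3, x + (1 : ℝ) • ((s * R) • y + (-s) • x) = (1 - s) • x + (s * R) • y :=
      fun x => by module
    simp only [hfl, show 1 + (1 : ℝ) * (-s) = 1 - s by ring, smul_comm (φ _) (1 - s),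
      integral_smul] at key
    rw [key, smul_neg, smul_neg, smul_comm]
  · intro x hx
    have hx' := hφB hx
    rw [mem_ball_zero_iff] at hx' ⊢
    rw [show x + (1 : ℝ) • ((s * R) • y + (-s) • x) = (1 - s) • x + (s * R) • y by module]
    calc _ ≤ ‖(1 - s) • x‖ + ‖(s * R) • y‖ := norm_add_le _ _
      _ ≤ (1 - s) * ‖x‖ + s * R := by
        rw [norm_smul, norm_smul, Real.norm_of_nonneg (by linarith), Real.norm_of_nonneg hb.le]
        exact add_le_add le_rfl (mul_le_of_le_one_right hb.le (not_lt.1 hy))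
      _ < R := by nlinarith

theorem exists_cutoff {r R : ℝ} (hr : 0 < r) (hrR : r < R) : ∃ ζ : E3 → ℝ, ContDiff ℝ ∞ ζ ∧
    tsupport ζ ⊆ {x | r ≤ ‖x‖} ∧ (∃ s < R, ∀ x, s < ‖x‖ → ζ x = 1) ∧
    ∃ C, ∀ x, ‖ζ x‖ ≤ C ∧ ∀ j, ‖fderiv ℝ ζ x (EuclideanSpace.single j 1)‖ ≤ C := by
  let b : ContDiffBump (0 : E3) := ⟨r, (r + R) / 2, hr, by linarith⟩
  have hb : ContDiff ℝ ∞ b := b.contDiff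
  have hfd : ∀ x e, fderiv ℝ (fun x => 1 - b x) x e = -fderiv ℝ b x e := fun x e => by
    rw [fderiv_const_sub]
    rfl
  choose C hC using fun j : Fin 3 =>
    (hasCompactSupport_partial b.hasCompactSupport
      (EuclideanSpace.single j 1)).exists_bound_of_continuous (continuous_partial hb _)
  refine ⟨fun x => 1 - b x, contDiff_const.sub hb, ?_, ⟨(r + R) / 2, by linarith, ?_⟩,
    1 + ∑ j, C j, fun x => ⟨?_, fun j => ?_⟩⟩
  · refine closure_minimal (fun x hx => ?_) (isClosed_le continuous_const continuous_norm)
    by_contra h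
    refine hx (sub_eq_zero.2 (b.one_of_mem_closedBall ?_).symm)
    exact mem_closedBall_zero_iff.2 (not_le.1 h).le
  · intro x hx
    simp only [b.zero_of_le_dist (x := x) (by simpa [b] using hx.le), sub_zero]
  · have h0 : 0 ≤ ∑ j, C j := Finset.sum_nonneg fun j _ => (norm_nonneg _).trans (hC j 0)
    rw [Real.norm_of_nonneg (sub_nonneg.2 b.le_one)]
    linarith [b.nonneg (x := x)]
  · rw [hfd, norm_neg]
    have := Finset.single_le_sum (f := C) (fun j _ => (norm_nonneg _).trans (hC j 0))
      (Finset.mem_univ j)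
    linarith [hC j x]

/-- The product `φ * ζ` is supported away from `closure D`, so it is a test function on the
truncation even when `φ` is only one on the ball. -/
theorem HasWeakPartial.cutoff {D : Set E3} {r R : ℝ} (hD : closure D ⊆ Metric.ball 0 r)
    {j : Fin 3} {u g : E3 → E3} (hu : IntegrableOn u (truncation D R))
    (hg : IntegrableOn g (truncation D R)) (h : HasWeakPartial (truncation D R) j u g)
    {ζ : E3 → ℝ} (hζ : ContDiff ℝ ∞ ζ) (hζr : tsupport ζ ⊆ {x | r ≤ ‖x‖}) :
    HasWeakPartial (Metric.ball 0 R) j ((truncation D R).indicator fun x => ζ x • u x)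
      ((truncation D R).indicator fun x =>
        ζ x • g x + fderiv ℝ ζ x (EuclideanSpace.single j 1) • u x) := by
  intro φ hφ hφc hφB
  set U := truncation D R
  have hU : MeasurableSet U := (isOpen_truncation D R).measurableSet
  set e : E3 := EuclideanSpace.single j 1
  have hts : tsupport (fun x => fderiv ℝ φ x e) ⊆ tsupport φ := tsupport_fderiv_apply_subset ℝ _
  have hfd : ∀ x, fderiv ℝ (fun x => φ x * ζ x) x e =
      φ x * fderiv ℝ ζ x e + ζ x * fderiv ℝ φ x e := fun x => by
    rw [fderiv_fun_mul (hφ.differentiable (by simp) x) (hζ.differentiable (by simp) x)]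
    rfl
  have hU' : tsupport (fun x => φ x * ζ x) ⊆ U := by
    intro x hx
    have h1 := hφB (tsupport_mul_subset_left hx)
    have h2 : r ≤ ‖x‖ := hζr (tsupport_mul_subset_right hx)
    refine ⟨h1, fun hxD => ?_⟩
    have := hD hxD
    rw [mem_ball_zero_iff] at this
    linarith
  have key : ∫ x in U, fderiv ℝ (fun x => φ x * ζ x) x e • u x =
      -∫ x in U, (φ x * ζ x) • g x := h (fun x => φ x * ζ x) (hφ.mul hζ) hφc.mul_right hU'
  have hφζ : Continuous fun x => φ x * fderiv ℝ ζ x e :=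
    hφ.continuous.mul (continuous_partial hζ e)
  have hζφ : Continuous fun x => ζ x * fderiv ℝ φ x e :=
    hζ.continuous.mul (continuous_partial hφ e)
  have i1 : IntegrableOn (fun x => (φ x * fderiv ℝ ζ x e) • u x) U :=
    integrable_test_smul hu hφζ hφc.mul_right
  have i2 : IntegrableOn (fun x => (ζ x * fderiv ℝ φ x e) • u x) U :=
    integrable_test_smul hu hζφ (hasCompactSupport_partial hφc e).mul_left
  have i3 : IntegrableOn (fun x => (φ x * ζ x) • g x) U :=
    integrable_test_smul hg (hφ.continuous.mul hζ.continuous) hφc.mul_right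
  have k1 : ∫ x in Metric.ball 0 R, fderiv ℝ φ x e • U.indicator (fun x => ζ x • u x) x =
      ∫ x in U, (ζ x * fderiv ℝ φ x e) • u x := by
    rw [setIntegral_smul_eq_integral (hts.trans hφB), ← setIntegral_smul_eq_indicator hU]
    simp only [smul_smul, mul_comm]
  have k2 : ∫ x in Metric.ball 0 R, φ x • U.indicator
      (fun x => ζ x • g x + fderiv ℝ ζ x e • u x) x =
      (∫ x in U, (φ x * ζ x) • g x) + ∫ x in U, (φ x * fderiv ℝ ζ x e) • u x := by
    rw [setIntegral_smul_eq_integral hφB, ← setIntegral_smul_eq_indicator hU,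
      ← integral_add i3 i1]
    simp only [smul_smul, smul_add]
  rw [k1, k2]
  simp only [hfd, add_smul] at key
  rw [integral_add i1 i2] at key
  rw [neg_add, ← key]
  abel

theorem memLp_dilAvg {R s : ℝ} (hb : 0 < s * R) {f : E3 → E3} (hf : Integrable f) :
    MemLp (dilAvg R s f) 2 (volume.restrict (Metric.ball 0 R)) := by
  have hc := continuous_dilAvg hb hf
  obtain ⟨C, hC⟩ := (isCompact_closedBall (0 : E3) R).exists_bound_of_continuousOn hc.continuousOn
  have : IsFiniteMeasure (volume.restrict (Metric.ball (0 : E3) R)) :=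
    ⟨by rw [Measure.restrict_apply_univ]; exact Metric.isBounded_ball.measure_lt_top⟩
  refine MemLp.of_bound hc.aestronglyMeasurable C ?_
  exact (ae_restrict_iff' Metric.isOpen_ball.measurableSet).2
    (Eventually.of_forall fun x hx => hC x (Metric.ball_subset_closedBall hx))

/-- Only the part `w = ζ • u` near the sphere is mollified; the rest of `u` is kept, so the boundary
of `D` plays no role. -/
theorem exists_approximation {D : Set E3} {r R : ℝ} (hr : 0 < r) (hrR : r < R)
    (hD : closure D ⊆ Metric.ball 0 r) {u : E3 → E3} (hu : MemH1 (truncation D R) u) :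
    ∃ v : ℕ → E3 → E3, (∀ k, MemH1 (truncation D R) (v k) ∧ ContinuousNearSphere R (v k)) ∧
      TendstoH1 (truncation D R) v u := by
  have hR : 0 < R := hr.trans hrR
  obtain ⟨ζ, hζ, hζr, ⟨s₀, hs₀, hζ1⟩, C, hC⟩ := exists_cutoff hr hrR
  set U := truncation D R with hUdef
  set B := Metric.ball (0 : E3) R with hB
  have hUo : IsOpen U := isOpen_truncation D R
  have hUb : Bornology.IsBounded U := isBounded_truncation D R
  have hUB : U ⊆ B := Set.sdiff_subset
  set G := fun j => weakPartial U j u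
  set w : E3 → E3 := U.indicator fun x => ζ x • u x with hw
  set H : Fin 3 → E3 → E3 := fun j => U.indicator fun x =>
    ζ x • G j x + fderiv ℝ ζ x (EuclideanSpace.single j 1) • u x with hH
  have mζ : ∀ f : E3 → E3, MemLp f 2 (volume.restrict U) →
      MemLp (fun x => ζ x • f x) 2 (volume.restrict U) := fun f hf =>
    hf.of_le_mul (c := C) (hζ.continuous.aestronglyMeasurable.smul hf.1)
      (Eventually.of_forall fun x => by
        rw [norm_smul]
        exact mul_le_mul_of_nonneg_right (hC x).1 (norm_nonneg _))
  have mζ' : ∀ j, MemLp (fun x => fderiv ℝ ζ x (EuclideanSpace.single j 1) • u x) 2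
      (volume.restrict U) := fun j =>
    hu.1.of_le_mul (c := C) ((continuous_partial hζ _).aestronglyMeasurable.smul hu.1.1)
      (Eventually.of_forall fun x => by
        rw [norm_smul]
        exact mul_le_mul_of_nonneg_right ((hC x).2 j) (norm_nonneg _))
  have mwU := mζ u hu.1
  have mHU := fun j => (mζ (G j) (hu.memLp_weakPartial j)).add (mζ' j)
  have mw : MemLp w 2 volume := (memLp_indicator_iff_restrict hUo.measurableSet).2 mwU
  have mH : ∀ j, MemLp (H j) 2 volume := fun j =>
    (memLp_indicator_iff_restrict hUo.measurableSet).2 (mHU j)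
  have iw : Integrable w :=
    (integrableOn_of_memLp_two hUb mwU).integrable_indicator hUo.measurableSet
  have iH : ∀ j, Integrable (H j) := fun j =>
    (integrableOn_of_memLp_two hUb (mHU j)).integrable_indicator hUo.measurableSet
  have hBw : B.indicator w = w := by
    rw [hw, Set.indicator_indicator, Set.inter_eq_right.2 hUB]
  have hBH : ∀ j, B.indicator (H j) = H j := fun j => by
    rw [hH, Set.indicator_indicator, Set.inter_eq_right.2 hUB]
  have hweak : ∀ j, HasWeakPartial B j w (H j) := fun j =>
    (hu.hasWeakPartial j).cutoff hD (integrableOn_of_memLp_two hUb hu.1)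
      (integrableOn_of_memLp_two hUb (hu.memLp_weakPartial j)) hζ hζr
  -- The shift by `2` keeps `s k < 1` already at `k = 0`.
  set s : ℕ → ℝ := fun k => 1 / ((k : ℝ) + 2) with hs
  have hs0 : ∀ k, 0 < s k := fun k => by positivity
  have hs1 : ∀ k, s k < 1 := fun k => by
    rw [hs, div_lt_one (by positivity)]
    linarith [(Nat.cast_nonneg k : (0 : ℝ) ≤ k)]
  have hsR : ∀ k, 0 < s k * R := fun k => mul_pos (hs0 k) hR
  have hslim0 : Tendsto s atTop (𝓝 0) := by
    have := (tendsto_one_div_add_atTop_nhds_zero_nat (𝕜 := ℝ)).comp (tendsto_add_atTop_nat 1)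
    refine this.congr fun k => ?_
    simp only [hs, Function.comp_apply, Nat.cast_add, Nat.cast_one]
    ring
  have hslim : Tendsto s atTop (𝓝[>] 0) :=
    tendsto_nhdsWithin_iff.2 ⟨hslim0, Eventually.of_forall hs0⟩
  set a : ℕ → E3 → E3 := fun k => dilAvg R (s k) w
  set A : ℕ → Fin 3 → E3 → E3 := fun k j => (1 - s k) • dilAvg R (s k) (H j)
  have ha : ∀ k j, HasWeakPartial U j (a k) (A k j) := fun k j => by
    have := (hweak j).dilAvg hR (hs0 k) (hs1 k) iw.integrableOn (iH j).integrableOn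
    rw [hBw, hBH] at this
    exact this.mono hUB
  have mres : ∀ {f : E3 → E3}, MemLp f 2 (volume.restrict B) → MemLp f 2 (volume.restrict U) :=
    fun hf => hf.mono_measure (Measure.restrict_mono_set _ hUB)
  have ma : ∀ k, MemLp (a k) 2 (volume.restrict U) := fun k => mres (memLp_dilAvg (hsR k) iw)
  have mA : ∀ k j, MemLp (A k j) 2 (volume.restrict U) := fun k j =>
    mres ((memLp_dilAvg (hsR k) (iH j)).const_smul _)
  -- The indicator matters on the sphere itself, outside `U`: there `U.indicator u` and `w` both
  -- vanish, so `v k` equals the continuous `a k` up to and including the sphere.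
  set v : ℕ → E3 → E3 := fun k => U.indicator u - (w - a k) with hv
  have hvU : ∀ k, u - (w - a k) =ᵐ[volume.restrict U] v k := fun k => by
    refine (ae_restrict_iff' hUo.measurableSet).2 (Eventually.of_forall fun x hx => ?_)
    simp [hv, hx]
  have mwr : MemLp w 2 (volume.restrict U) := mw.restrict _
  have mHr : ∀ j, MemLp (H j) 2 (volume.restrict U) := fun j => (mH j).restrict _
  have I : ∀ {f : E3 → E3}, MemLp f 2 (volume.restrict U) → IntegrableOn f U :=
    integrableOn_of_memLp_two hUb
  have hvweak : ∀ k j, HasWeakPartial U j (v k) (G j - (H j - A k j)) := fun k j =>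
    ((hu.hasWeakPartial j).sub (I hu.1) (I (mwr.sub (ma k))) (I (hu.memLp_weakPartial j))
      (I ((mHr j).sub (mA k j)))
      (((hweak j).mono hUB).sub (I mwr) (I (ma k)) (I (mHr j)) (I (mA k j)) (ha k j))).congr
      (hvU k)
  have mvG : ∀ k j, MemLp (G j - (H j - A k j)) 2 (volume.restrict U) := fun k j =>
    (hu.memLp_weakPartial j).sub ((mHr j).sub (mA k j))
  refine ⟨v, fun k => ⟨⟨(memLp_congr_ae (hvU k)).1 (hu.1.sub (mwr.sub (ma k))), fun j =>
    ⟨_, mvG k j, hvweak k j⟩⟩, max s₀ 0, max_lt hs₀ hR, ?_⟩, ?_, fun j => ?_⟩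
  · refine ((continuous_dilAvg (hsR k) iw).continuousOn (s := _)).congr fun x hx => ?_
    have hxs : s₀ < ‖x‖ := by
      have := hx.2
      rw [mem_closedBall_zero_iff, not_le] at this
      exact (le_max_left _ _).trans_lt this
    by_cases hxU : x ∈ U
    · simp [hv, hw, hxU, hζ1 x hxs, a]
    · simp [hv, hw, hxU, a]
  · have h1 := (tendsto_dilAvg hR iw mw).comp hslim
    refine tendsto_of_tendsto_of_tendsto_of_le_of_le tendsto_const_nhds h1
      (fun _ => zero_le) fun k => ?_
    calc _ = eLpNorm (a k - w) 2 (volume.restrict U) := by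
          refine eLpNorm_congr_ae ?_
          filter_upwards [hvU k] with x hx
          simp only [Pi.sub_apply] at hx ⊢
          rw [← hx]
          abel
      _ ≤ _ := eLpNorm_restrict_mono _ hUB
  · have h1 := (tendsto_dilAvg hR (iH j) (mH j)).comp hslim
    have h2 : Tendsto (fun k => ENNReal.ofReal (s k) * eLpNorm (H j) 2 volume) atTop (𝓝 0) := by
      have := ENNReal.Tendsto.mul_const (b := eLpNorm (H j) 2 volume)
        (ENNReal.tendsto_ofReal hslim0) (Or.inr (mH j).2.ne)
      simpa using this
    have h3 := h1.add h2
    rw [add_zero] at h3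
    refine tendsto_of_tendsto_of_tendsto_of_le_of_le tendsto_const_nhds h3
      (fun _ => zero_le) fun k => ?_
    have mAv : MemLp (dilAvg R (s k) (H j)) 2 (volume.restrict U) :=
      mres (memLp_dilAvg (hsR k) (iH j))
    calc _ = eLpNorm ((1 - s k) • (dilAvg R (s k) (H j) - H j) - s k • H j) 2
          (volume.restrict U) := by
          refine eLpNorm_congr_ae ?_
          filter_upwards [weakPartial_ae_eq hUo hUb (mvG k j) (hvweak k j)] with x hx
          simp only [Pi.sub_apply] at hx ⊢
          rw [hx]
          simp only [Pi.smul_apply, Pi.sub_apply, A, G]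
          module
      _ ≤ eLpNorm ((1 - s k) • (dilAvg R (s k) (H j) - H j)) 2 (volume.restrict U) +
          eLpNorm (s k • H j) 2 (volume.restrict U) :=
        eLpNorm_sub_le ((mAv.sub (mHr j)).const_smul _).1 ((mHr j).const_smul _).1 (by norm_num)
      _ ≤ _ := by
        rw [eLpNorm_const_smul, eLpNorm_const_smul]
        refine add_le_add ?_ ?_
        · refine (mul_le_of_le_one_left' ?_).trans (eLpNorm_restrict_mono _ hUB)
          rw [Real.enorm_of_nonneg (by linarith [hs1 k]), ENNReal.ofReal_le_one]
          linarith [hs0 k]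
        · rw [Real.enorm_of_nonneg (hs0 k).le]
          gcongr
          exact Measure.restrict_le_self

/-! ### Existence of traces and the Poincaré inequality. -/

theorem gradSum_sub_le {U : Set E3} (hU : IsOpen U) (hb : Bornology.IsBounded U)
    {v w u : E3 → E3} (hv : MemH1 U v) (hw : MemH1 U w) (hu : MemH1 U u) :
    gradSum U (v - w) ≤
      (∑ j, eLpNorm (weakPartial U j v - weakPartial U j u) 2 (volume.restrict U)) +
      ∑ j, eLpNorm (weakPartial U j w - weakPartial U j u) 2 (volume.restrict U) := by
  rw [← Finset.sum_add_distrib]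
  refine Finset.sum_le_sum fun j _ => ?_
  have m := fun {f : E3 → E3} (hf : MemH1 U f) => (hf.memLp_weakPartial j).1
  calc _ = eLpNorm ((weakPartial U j v - weakPartial U j u) -
          (weakPartial U j w - weakPartial U j u)) 2 (volume.restrict U) := by
        refine eLpNorm_congr_ae ?_
        filter_upwards [hv.weakPartial_sub_ae_eq hU hb hw j] with x hx
        rw [hx]
        simp
    _ ≤ _ := eLpNorm_sub_le ((m hv).sub (m hu)) ((m hw).sub (m hu)) (by norm_num)

/-- The trace inequality applied to differences `v k - v l` makes the boundary values Cauchy in `L²`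
of the sphere, which is complete. -/
theorem exists_isTrace {D : Set E3} {r R : ℝ} (hr : 0 < r) (hrR : r < R)
    (hD : closure D ⊆ Metric.ball 0 r) {u : E3 → E3} (hu : MemH1 (truncation D R) u) :
    ∃ T, IsTrace D R u T := by
  have hR : 0 < R := hr.trans hrR
  obtain ⟨v, hv, hlim⟩ := exists_approximation hr hrR hD hu
  obtain ⟨C, hC⟩ := exists_shell_and_trace_bound hr hrR hD
  set U := truncation D R
  have hUo : IsOpen U := isOpen_truncation D R
  have hUb : Bornology.IsBounded U := isBounded_truncation D R
  have mv : ∀ k, MemLp (v k) 2 (surfaceMeasure R) := fun k => (hv k).2.memLp hR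
  set b : ℕ → ℝ≥0∞ := fun k => C *
    ((∑ j, eLpNorm (weakPartial U j (v k) - weakPartial U j u) 2 (volume.restrict U)) +
      eLpNorm (v k - u) 2 (volume.restrict U)) with hb
  have hb0 : Tendsto b atTop (𝓝 0) := by
    have h1 := tendsto_finsetSum Finset.univ fun j _ => hlim.2 j
    have h2 := ENNReal.Tendsto.const_mul (a := (C : ℝ≥0∞)) (h1.add hlim.1)
      (Or.inr ENNReal.coe_ne_top)
    simpa using h2
  have hdist : ∀ k l, edist ((mv k).toLp (v k)) ((mv l).toLp (v l)) ≤ b k + b l := by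
    intro k l
    rw [Lp.edist_toLp_toLp]
    refine ((hC (v k - v l) ((hv k).1.sub hUb (hv l).1) ((hv k).2.sub (hv l).2)).2).trans ?_
    rw [hb, ← mul_add]
    refine mul_le_mul_right ?_ _
    have h1 := gradSum_sub_le hUo hUb (hv k).1 (hv l).1 hu
    have h2 : eLpNorm (v k - v l) 2 (volume.restrict U) ≤
        eLpNorm (v k - u) 2 (volume.restrict U) + eLpNorm (v l - u) 2 (volume.restrict U) := by
      rw [show v k - v l = (v k - u) - (v l - u) by abel]
      exact eLpNorm_sub_le ((hv k).1.1.1.sub hu.1.1) ((hv l).1.1.1.sub hu.1.1) (by norm_num)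
    refine (add_le_add h1 h2).trans (le_of_eq ?_)
    abel
  have hcau : CauchySeq fun k => (mv k).toLp (v k) := by
    rw [EMetric.cauchySeq_iff]
    intro ε hε
    have hε2 : 0 < ε / 2 := ENNReal.half_pos hε.ne'
    obtain ⟨N, hN⟩ := eventually_atTop.1 (hb0.eventually (gt_mem_nhds hε2))
    refine ⟨N, fun k hk l hl => (hdist k l).trans_lt ?_⟩
    rw [← ENNReal.add_halves ε]
    exact ENNReal.add_lt_add (hN k hk) (hN l hl)
  obtain ⟨T, hT⟩ := cauchySeq_tendsto_of_complete hcau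
  refine ⟨T, Lp.memLp T, v, hv, hlim, ?_⟩
  have h1 := tendsto_iff_edist_tendsto_0.1 hT
  refine h1.congr fun k => ?_
  rw [Lp.edist_def]
  refine eLpNorm_congr_ae ?_
  filter_upwards [(mv k).coeFn_toLp] with x hx
  simp [hx]

/-- The sum of the `L²` norms of the gradient of `u` and of its trace. -/
noncomputable def energySum (D : Set E3) (R : ℝ) (u : E3 → E3) : ℝ≥0∞ :=
  gradSum (truncation D R) u + eLpNorm (trace D R u) 2 (surfaceMeasure R)

theorem isTrace_trace {D : Set E3} {r R : ℝ} (hr : 0 < r) (hrR : r < R)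
    (hD : closure D ⊆ Metric.ball 0 r) {u : E3 → E3} (hu : MemH1 (truncation D R) u) :
    IsTrace D R u (trace D R u) := by
  have h := exists_isTrace hr hrR hD hu
  rw [trace, dif_pos h]
  exact h.choose_spec

/-- The shell bound for continuous boundary values passes to the limit along the sequence that
defines the trace. -/
theorem exists_shell_bound {D : Set E3} {r R : ℝ} (hr : 0 < r) (hrR : r < R)
    (hD : closure D ⊆ Metric.ball 0 r) : ∃ C : ℝ≥0, ∀ u : E3 → E3, MemH1 (truncation D R) u →
      eLpNorm u 2 (volume.restrict (shell r R)) ≤ C * energySum D R u := by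
  have hR : 0 < R := hr.trans hrR
  obtain ⟨C, hC⟩ := exists_shell_and_trace_bound hr hrR hD
  refine ⟨C, fun u hu => ?_⟩
  obtain ⟨hT, v, hv, hlim, hvT⟩ := isTrace_trace hr hrR hD hu
  set U := truncation D R
  set T := trace D R u
  have hSU : shell r R ⊆ U := shell_subset_truncation hD
  have hbound : ∀ k, eLpNorm u 2 (volume.restrict (shell r R)) ≤
      eLpNorm (v k - u) 2 (volume.restrict U) + C * ((gradSum U u +
        ∑ j, eLpNorm (weakPartial U j (v k) - weakPartial U j u) 2 (volume.restrict U)) +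
        (eLpNorm T 2 (surfaceMeasure R) + eLpNorm (v k - T) 2 (surfaceMeasure R))) := by
    intro k
    have hmono := Measure.restrict_mono_set (volume : Measure E3) hSU
    have mvk := (hv k).1.1.1
    have h1 : eLpNorm u 2 (volume.restrict (shell r R)) ≤
        eLpNorm (v k - u) 2 (volume.restrict U) + eLpNorm (v k) 2 (volume.restrict (shell r R)) := by
      calc _ = eLpNorm (v k - (v k - u)) 2 (volume.restrict (shell r R)) := by
            rw [sub_sub_cancel]
        _ ≤ _ := eLpNorm_sub_le (mvk.mono_measure hmono)
          ((mvk.sub hu.1.1).mono_measure hmono) (by norm_num)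
        _ ≤ _ := by
          rw [add_comm]
          gcongr
    have h2 : gradSum U (v k) ≤ gradSum U u +
        ∑ j, eLpNorm (weakPartial U j (v k) - weakPartial U j u) 2 (volume.restrict U) := by
      rw [gradSum, gradSum, ← Finset.sum_add_distrib]
      refine Finset.sum_le_sum fun j _ => ?_
      calc _ = eLpNorm (weakPartial U j u + (weakPartial U j (v k) - weakPartial U j u)) 2
            (volume.restrict U) := by rw [add_sub_cancel]
        _ ≤ _ := eLpNorm_add_le (hu.memLp_weakPartial j).1
          (((hv k).1.memLp_weakPartial j).1.sub (hu.memLp_weakPartial j).1) (by norm_num)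
    have h3 : eLpNorm (v k) 2 (surfaceMeasure R) ≤
        eLpNorm T 2 (surfaceMeasure R) + eLpNorm (v k - T) 2 (surfaceMeasure R) := by
      have hvk : ContinuousNearSphere R (v k) := (hv k).2
      calc _ = eLpNorm (T + (v k - T)) 2 (surfaceMeasure R) := by rw [add_sub_cancel]
        _ ≤ _ := eLpNorm_add_le hT.1 ((hvk.aestronglyMeasurable hR).sub hT.1) (by norm_num)
    refine h1.trans (add_le_add le_rfl (((hC (v k) (hv k).1 (hv k).2).1).trans ?_))
    gcongr
  have hlim' : Tendsto (fun k => eLpNorm (v k - u) 2 (volume.restrict U) + C * ((gradSum U u +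
        ∑ j, eLpNorm (weakPartial U j (v k) - weakPartial U j u) 2 (volume.restrict U)) +
        (eLpNorm T 2 (surfaceMeasure R) + eLpNorm (v k - T) 2 (surfaceMeasure R)))) atTop
      (𝓝 (0 + C * ((gradSum U u + ∑ _j : Fin 3, 0) + (eLpNorm T 2 (surfaceMeasure R) + 0)))) := by
    refine hlim.1.add (ENNReal.Tendsto.const_mul ?_ (Or.inr ENNReal.coe_ne_top))
    exact ((tendsto_finsetSum _ fun j _ => hlim.2 j).const_add _).add (hvT.const_add _)
  have := ge_of_tendsto' hlim' hbound
  simpa [energySum] using this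

theorem exists_poincare {D : Set E3} (hD_open : IsOpen D) (hD_lip : HasLipschitzBoundary D)
    (hD_ext : IsConnected (closure D)ᶜ) {R : ℝ} (hR : 0 < R)
    (hDR : closure D ⊆ Metric.ball 0 R) :
    ∃ C : ℝ≥0, ∀ u : E3 → E3, MemH1 (truncation D R) u →
      eLpNorm u 2 (volume.restrict (truncation D R)) ≤ C * energySum D R u := by
  obtain ⟨r, ⟨hr, hrR⟩, hD⟩ := exists_pos_lt_subset_ball hR isClosed_closure hDR
  obtain ⟨C, hC⟩ := exists_shell_bound hr hrR hD
  -- Pairing each `u` with its own energy makes the propagated bounds uniform in `u`.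
  set Q : Set ((E3 → E3) × ℝ≥0∞) :=
    {p | MemH1 (truncation D R) p.1 ∧ p.2 = energySum D R p.1} with hQ
  have hQ' : ∀ p ∈ Q, MemH1 (truncation D R) p.1 ∧ gradSum (truncation D R) p.1 ≤ p.2 := by
    rintro p ⟨h1, h2⟩
    exact ⟨h1, h2 ▸ le_self_add⟩
  have hann : ∀ x, r < ‖x‖ → LocalBound (truncation D R) Q x := by
    refine fun x hx => ⟨‖x‖ - r, sub_pos.2 hx, C, fun p hp => ?_⟩
    rw [hp.2]
    refine (eLpNorm_restrict_mono _ fun y hy => ?_).trans (hC p.1 hp.1)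
    refine ⟨?_, mem_ball_zero_iff.1 hy.2.1⟩
    have h1 : ‖y - x‖ < ‖x‖ - r := by rw [← dist_eq_norm]; exact hy.1
    have h2 := norm_sub_norm_le x y
    rw [norm_sub_rev] at h2
    linarith
  obtain ⟨C', hC'⟩ := exists_bound_of_localBound (isBounded_truncation D R)
    (localBound_closure hD_open hD_lip hD_ext hrR hQ' hDR hann)
  exact ⟨C', fun u hu => hC' (u, _) ⟨hu, rfl⟩⟩

/-! ### Bounds for the two forms. -/

theorem toReal_eLpNorm_two_sq {α F : Type*} [MeasurableSpace α] [NormedAddCommGroup F]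
    {μ : Measure α} {f : α → F} (hf : MemLp f 2 μ) :
    (eLpNorm f 2 μ).toReal ^ 2 = ∫ x, ‖f x‖ ^ 2 ∂μ := by
  rw [← ENNReal.toReal_pow, sq_eLpNorm_two, integral_eq_lintegral_of_nonneg_ae
    (f := fun x => ‖f x‖ ^ 2) (Eventually.of_forall fun x => by positivity) (hf.1.norm.pow 2)]
  congr 1
  refine lintegral_congr fun x => ?_
  rw [ENNReal.ofReal_pow (norm_nonneg _), ofReal_norm]

/-- Cauchy–Schwarz. No measurability of `f` is needed, as the norm of a Bochner integral never
exceeds the lower integral of the norm. -/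
theorem norm_integral_le_mul_eLpNorm {α F F₁ F₂ : Type*} [MeasurableSpace α]
    [NormedAddCommGroup F] [NormedSpace ℝ F] [NormedAddCommGroup F₁] [NormedAddCommGroup F₂]
    {μ : Measure α} {a : α → F₁} {b : α → F₂} (ha : MemLp a 2 μ) (hb : MemLp b 2 μ) {K : ℝ}
    (hK : 0 ≤ K) {f : α → F} (hf : ∀ᵐ x ∂μ, ‖f x‖ ≤ K * (‖a x‖ * ‖b x‖)) :
    ‖∫ x, f x ∂μ‖ ≤ K * ((eLpNorm a 2 μ).toReal * (eLpNorm b 2 μ).toReal) := by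
  have h1 : ‖∫ x, f x ∂μ‖ₑ ≤ ENNReal.ofReal K * (eLpNorm a 2 μ * eLpNorm b 2 μ) := by
    calc _ ≤ ∫⁻ x, ‖f x‖ₑ ∂μ := enorm_integral_le_lintegral_enorm _
      _ ≤ ∫⁻ x, ENNReal.ofReal K * (‖a x‖ₑ * ‖b x‖ₑ) ∂μ := by
        refine lintegral_mono_ae ?_
        filter_upwards [hf] with x hx
        rw [← ofReal_norm, ← ofReal_norm, ← ofReal_norm, ← ENNReal.ofReal_mul (norm_nonneg _),
          ← ENNReal.ofReal_mul hK]
        exact ENNReal.ofReal_le_ofReal hx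
      _ = ENNReal.ofReal K * ∫⁻ x, ‖a x‖ₑ * ‖b x‖ₑ ∂μ :=
        lintegral_const_mul' _ _ ENNReal.ofReal_ne_top
      _ ≤ _ := by
        gcongr
        have := ENNReal.lintegral_mul_le_Lp_mul_Lq μ Real.HolderConjugate.two_two
          ha.1.enorm hb.1.enorm
        rw [eLpNorm_eq_lintegral_rpow_enorm_toReal (by norm_num) (by norm_num),
          eLpNorm_eq_lintegral_rpow_enorm_toReal (by norm_num) (by norm_num)]
        simpa using this
  have h2 := ENNReal.toReal_mono (ENNReal.mul_ne_top ENNReal.ofReal_ne_top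
    (ENNReal.mul_ne_top ha.2.ne hb.2.ne)) h1
  simpa [ENNReal.toReal_mul, ENNReal.toReal_ofReal hK] using h2

theorem norm_e1Cross_le (x : E3) : ‖e1Cross x‖ ≤ ‖x‖ := by
  rw [EuclideanSpace.norm_eq, EuclideanSpace.norm_eq]
  apply Real.sqrt_le_sqrt
  simp only [Fin.sum_univ_three, e1Cross, crossProduct]
  simp
  nlinarith [sq_nonneg (x 0)]

/-- Each of the three partial derivatives contributes one `normR`; undoing the weight `τ / 2` on the
trace contributes `√(2 / τ)`. -/
theorem energySum_toReal_le {D : Set E3} {τ R : ℝ} (hτ : 0 < τ) {u : E3 → E3}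
    (hu : MemH1 (truncation D R) u) (hT : MemLp (trace D R u) 2 (surfaceMeasure R)) :
    (energySum D R u).toReal ≤ (3 + Real.sqrt (2 / τ)) * normR D τ R u := by
  set U := truncation D R
  set g := ∫ x in U, ∑ j : Fin 3, ‖weakPartial U j u x‖ ^ 2
  set t := ∫ x, ‖trace D R u x‖ ^ 2 ∂(surfaceMeasure R)
  have hg0 : 0 ≤ g := integral_nonneg fun x => by positivity
  have ht0 : 0 ≤ t := integral_nonneg fun x => by positivity
  have hn : normR D τ R u = Real.sqrt (g + τ / 2 * t) := rfl
  have hj : ∀ j, (eLpNorm (weakPartial U j u) 2 (volume.restrict U)).toReal ≤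
      normR D τ R u := by
    intro j
    rw [hn]
    apply Real.le_sqrt_of_sq_le
    rw [toReal_eLpNorm_two_sq (hu.memLp_weakPartial j)]
    have : ∫ x in U, ‖weakPartial U j u x‖ ^ 2 ≤ g := by
      have hi : ∀ i, Integrable (fun x => ‖weakPartial U i u x‖ ^ 2) (volume.restrict U) :=
        fun i => (hu.memLp_weakPartial i).integrable_norm_pow (p := 2) (by norm_num)
      refine integral_mono (hi j) (integrable_finsetSum _ fun i _ => hi i) fun x => ?_
      exact Finset.single_le_sum (f := fun j => ‖weakPartial U j u x‖ ^ 2)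
        (fun i _ => by positivity) (Finset.mem_univ j)
    have : 0 ≤ τ / 2 * t := by positivity
    linarith
  have ht : (eLpNorm (trace D R u) 2 (surfaceMeasure R)).toReal ≤
      Real.sqrt (2 / τ) * normR D τ R u := by
    rw [hn, ← Real.sqrt_mul (by positivity)]
    apply Real.le_sqrt_of_sq_le
    rw [toReal_eLpNorm_two_sq hT]
    have : 2 / τ * (g + τ / 2 * t) = 2 / τ * g + t := by field_simp
    rw [this]
    have : 0 ≤ 2 / τ * g := by positivity
    change t ≤ _
    linarith
  rw [energySum, ENNReal.toReal_add hu.gradSum_lt_top.ne hT.2.ne, gradSum,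
    ENNReal.toReal_sum fun j _ => (hu.memLp_weakPartial j).2.ne, Fin.sum_univ_three]
  linarith [hj 0, hj 1, hj 2]

/-- The pointwise size of `u` and its weak partial derivatives. -/
noncomputable def jetNorm (U : Set E3) (u : E3 → E3) (x : E3) : ℝ :=
  ‖u x‖ + ∑ j, ‖weakPartial U j u x‖

theorem jetNorm_nonneg (U : Set E3) (u : E3 → E3) (x : E3) : 0 ≤ jetNorm U u x :=
  add_nonneg (norm_nonneg _) (Finset.sum_nonneg fun _ _ => norm_nonneg _)

theorem norm_le_jetNorm (U : Set E3) (u : E3 → E3) (x : E3) : ‖u x‖ ≤ jetNorm U u x :=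
  le_add_of_nonneg_right (Finset.sum_nonneg fun _ _ => norm_nonneg _)

theorem sum_norm_weakPartial_le_jetNorm (U : Set E3) (u : E3 → E3) (x : E3) :
    ∑ j, ‖weakPartial U j u x‖ ≤ jetNorm U u x :=
  le_add_of_nonneg_left (norm_nonneg _)

theorem norm_weakPartial_le_jetNorm (U : Set E3) (u : E3 → E3) (x : E3) (j : Fin 3) :
    ‖weakPartial U j u x‖ ≤ jetNorm U u x :=
  (Finset.single_le_sum (f := fun j => ‖weakPartial U j u x‖) (fun _ _ => norm_nonneg _)
    (Finset.mem_univ j)).trans (sum_norm_weakPartial_le_jetNorm U u x)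

theorem MemH1.memLp_jetNorm {U : Set E3} {u : E3 → E3} (hu : MemH1 U u) :
    MemLp (jetNorm U u) 2 (volume.restrict U) :=
  hu.1.norm.add (memLp_finsetSum _ fun j _ => (hu.memLp_weakPartial j).norm)

theorem MemH1.eLpNorm_jetNorm_le {U : Set E3} {u : E3 → E3} (hu : MemH1 U u) :
    eLpNorm (jetNorm U u) 2 (volume.restrict U) ≤
      eLpNorm u 2 (volume.restrict U) + gradSum U u := by
  have h1 : ∀ j ∈ Finset.univ, AEStronglyMeasurable (fun x => ‖weakPartial U j u x‖)
      (volume.restrict U) := fun j _ => (hu.memLp_weakPartial j).1.norm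
  have h2 := eLpNorm_sum_le h1 (p := 2) (by norm_num)
  simp only [eLpNorm_norm] at h2
  have h3 : jetNorm U u = (fun x => ‖u x‖) + ∑ j, fun x => ‖weakPartial U j u x‖ := by
    ext x
    simp [jetNorm]
  rw [h3]
  refine (eLpNorm_add_le hu.1.1.norm (Finset.aestronglyMeasurable_sum _ h1) (by norm_num)).trans ?_
  rw [eLpNorm_norm]
  exact add_le_add le_rfl h2

theorem norm_gradient_integrand_le (U : Set E3) {τ : ℝ} (hτ : 0 < τ) (u w : E3 → E3) (x : E3) :
    ‖(∑ j : Fin 3, inner ℝ (weakPartial U j u x) (weakPartial U j w x)) +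
        τ * inner ℝ (weakPartial U 0 u x) (w x)‖ ≤
      (1 + τ) * (‖jetNorm U u x‖ * ‖jetNorm U w x‖) := by
  have hu0 := jetNorm_nonneg U u x
  have hw0 := jetNorm_nonneg U w x
  rw [Real.norm_of_nonneg hu0, Real.norm_of_nonneg hw0, add_mul, one_mul]
  refine (norm_add_le _ _).trans (add_le_add ?_ ?_)
  · refine (norm_sum_le _ _).trans ?_
    calc _ ≤ ∑ j, ‖weakPartial U j u x‖ * jetNorm U w x := by
          refine Finset.sum_le_sum fun j _ => (norm_inner_le_norm _ _).trans ?_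
          gcongr
          exact norm_weakPartial_le_jetNorm U w x j
      _ ≤ _ := by
          rw [← Finset.sum_mul]
          gcongr
          exact sum_norm_weakPartial_le_jetNorm U u x
  · rw [norm_mul, Real.norm_of_nonneg hτ.le]
    gcongr
    refine (norm_inner_le_norm _ _).trans ?_
    gcongr
    · exact norm_weakPartial_le_jetNorm U u x 0
    · exact norm_le_jetNorm U w x

theorem norm_rotation_integrand_le (U : Set E3) (ρ : ℝ) {R : ℝ} (u w : E3 → E3)
    {x : E3} (hx : ‖x‖ ≤ R) :
    ‖inner ℝ (-(∑ j : Fin 3, (ρ • e1Cross x) j • weakPartial U j u x) + ρ • e1Cross (u x))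
        (w x)‖ ≤ |ρ| * (R + 1) * (‖jetNorm U u x‖ * ‖jetNorm U w x‖) := by
  have hu0 := jetNorm_nonneg U u x
  have hw0 := jetNorm_nonneg U w x
  have hR0 : 0 ≤ R := (norm_nonneg x).trans hx
  rw [Real.norm_of_nonneg hu0, Real.norm_of_nonneg hw0]
  refine (norm_inner_le_norm _ _).trans ?_
  have h1 : ‖∑ j : Fin 3, (ρ • e1Cross x) j • weakPartial U j u x‖ ≤ |ρ| * R * jetNorm U u x := by
    calc _ ≤ ∑ j, |ρ| * R * ‖weakPartial U j u x‖ := by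
          refine (norm_sum_le _ _).trans (Finset.sum_le_sum fun j _ => ?_)
          rw [norm_smul]
          gcongr
          refine (PiLp.norm_apply_le _ j).trans ?_
          rw [norm_smul, Real.norm_eq_abs]
          gcongr
          exact (norm_e1Cross_le x).trans hx
      _ ≤ _ := by
          rw [← Finset.mul_sum]
          gcongr
          exact sum_norm_weakPartial_le_jetNorm U u x
  have h2 : ‖ρ • e1Cross (u x)‖ ≤ |ρ| * jetNorm U u x := by
    rw [norm_smul, Real.norm_eq_abs]
    gcongr
    exact (norm_e1Cross_le _).trans (norm_le_jetNorm U u x)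
  calc _ ≤ (|ρ| * R * jetNorm U u x + |ρ| * jetNorm U u x) * jetNorm U w x := by
        gcongr
        · refine (norm_add_le _ _).trans (add_le_add ?_ h2)
          rwa [norm_neg]
        · exact norm_le_jetNorm U w x
    _ = _ := by ring

theorem ae_norm_eq_surfaceMeasure {R : ℝ} (hR : 0 < R) :
    ∀ᵐ x ∂(surfaceMeasure R), ‖x‖ = R := by
  refine Measure.ae_smul_measure ?_ _
  rw [(measurableEmbedding_sphere hR).ae_map_iff]
  refine Eventually.of_forall fun θ => ?_
  simp [norm_smul, abs_of_pos hR]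

theorem norm_surface_integrand_le {R : ℝ} (hR : 0 < R) (S T : E3 → E3) {x : E3} (hx : ‖x‖ = R) :
    ‖inner ℝ (S x) (T x) * (1 - x 0 / R)‖ ≤ 2 * (‖S x‖ * ‖T x‖) := by
  have h1 : |x 0| ≤ R := hx ▸ PiLp.norm_apply_le x 0
  have h2 : ‖1 - x 0 / R‖ ≤ 2 := by
    have h3 : |x 0 / R| ≤ 1 := by
      rw [abs_div, abs_of_pos hR]
      exact div_le_one_of_le₀ h1 hR.le
    rw [Real.norm_eq_abs, abs_le]
    constructor <;> linarith [(abs_le.1 h3).1, (abs_le.1 h3).2]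
  rw [norm_mul, mul_comm 2]
  exact mul_le_mul (norm_inner_le_norm _ _) h2 (norm_nonneg _) (by positivity)

theorem abs_form_le {D : Set E3} {τ : ℝ} (hτ : 0 < τ) (ρ : ℝ) {R : ℝ} (hR : 0 < R)
    {u w : E3 → E3} (hu : MemH1 (truncation D R) u) (hw : MemH1 (truncation D R) w)
    (hTu : MemLp (trace D R u) 2 (surfaceMeasure R))
    (hTw : MemLp (trace D R w) 2 (surfaceMeasure R)) :
    |aForm D τ R u w + deltaForm D ρ R u w| ≤
      (1 + τ + |ρ| * (R + 1)) *
        ((eLpNorm (jetNorm (truncation D R) u) 2 (volume.restrict (truncation D R))).toReal *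
          (eLpNorm (jetNorm (truncation D R) w) 2 (volume.restrict (truncation D R))).toReal) +
      τ * ((eLpNorm (trace D R u) 2 (surfaceMeasure R)).toReal *
        (eLpNorm (trace D R w) 2 (surfaceMeasure R)).toReal) := by
  have hU := (isOpen_truncation D R).measurableSet
  have h1 := norm_integral_le_mul_eLpNorm hu.memLp_jetNorm hw.memLp_jetNorm
    (by positivity : 0 ≤ 1 + τ)
    (Eventually.of_forall fun x => norm_gradient_integrand_le (truncation D R) hτ u w x)
  have h2 := norm_integral_le_mul_eLpNorm hu.memLp_jetNorm hw.memLp_jetNorm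
    (by positivity : 0 ≤ |ρ| * (R + 1))
    ((ae_restrict_iff' hU).2 (Eventually.of_forall fun x hx =>
      norm_rotation_integrand_le (truncation D R) ρ u w (mem_ball_zero_iff.1 hx.1).le))
  have h3 := norm_integral_le_mul_eLpNorm hTu hTw zero_le_two
    ((ae_norm_eq_surfaceMeasure hR).mono fun x hx =>
      norm_surface_integrand_le hR (trace D R u) (trace D R w) hx)
  have h4 := mul_le_mul_of_nonneg_left h3 (by positivity : 0 ≤ τ / 2)
  rw [Real.norm_eq_abs] at h1 h2 h4
  rw [aForm, deltaForm]
  refine (abs_add_le _ _).trans ((add_le_add_left (abs_add_le _ _) _).trans ?_)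
  rw [abs_mul (τ / 2), abs_of_pos (by positivity : 0 < τ / 2)]
  linarith

end TruncatedFlow

theorem mainTheorem9
    (D : Set TruncatedFlow.E3) (hD_open : IsOpen D) (hD_bdd : Bornology.IsBounded D)
    (hD_lip : TruncatedFlow.HasLipschitzBoundary D)
    (hD_ext : IsConnected (closure D)ᶜ)
    (τ : ℝ) (hτ : 0 < τ) (ρ : ℝ) (hρ : ρ ≠ 0)
    (R : ℝ) (hR : 0 < R) (hDR : closure D ⊆ Metric.ball 0 R) :
    ∃ C : ℝ, 0 < C ∧ ∀ u w : TruncatedFlow.E3 → TruncatedFlow.E3,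
      TruncatedFlow.MemH1 (TruncatedFlow.truncation D R) u →
      TruncatedFlow.MemH1 (TruncatedFlow.truncation D R) w →
        |TruncatedFlow.aForm D τ R u w + TruncatedFlow.deltaForm D ρ R u w|
          ≤ C * TruncatedFlow.normR D τ R u * TruncatedFlow.normR D τ R w := by
  open TruncatedFlow in
  obtain ⟨Cp, hCp⟩ := exists_poincare hD_open hD_lip hD_ext hR hDR
  obtain ⟨r, ⟨hr, hrR⟩, hD⟩ := exists_pos_lt_subset_ball hR isClosed_closure hDR
  set k : ℝ := 3 + Real.sqrt (2 / τ) with hk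
  have hk0 : 0 < k := by positivity
  have hT : ∀ {u}, MemH1 (truncation D R) u → MemLp (trace D R u) 2 (surfaceMeasure R) :=
    fun hu => (isTrace_trace hr hrR hD hu).1
  have hN : ∀ {u}, MemH1 (truncation D R) u → energySum D R u ≠ ⊤ := fun hu =>
    ENNReal.add_ne_top.2 ⟨hu.gradSum_lt_top.ne, (hT hu).2.ne⟩
  have hjet : ∀ {u}, MemH1 (truncation D R) u →
      (eLpNorm (jetNorm (truncation D R) u) 2 (volume.restrict (truncation D R))).toReal ≤
        (Cp + 1) * (k * normR D τ R u) := by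
    intro u hu
    have h1 : eLpNorm (jetNorm (truncation D R) u) 2 (volume.restrict (truncation D R)) ≤
        ((Cp + 1 : ℝ≥0) : ℝ≥0∞) * energySum D R u := by
      refine hu.eLpNorm_jetNorm_le.trans ?_
      push_cast
      rw [add_mul, one_mul]
      exact add_le_add (hCp u hu) le_self_add
    have h2 := ENNReal.toReal_mono (ENNReal.mul_ne_top ENNReal.coe_ne_top (hN hu)) h1
    rw [ENNReal.toReal_mul, ENNReal.coe_toReal] at h2
    push_cast at h2
    exact h2.trans (mul_le_mul_of_nonneg_left (energySum_toReal_le hτ hu (hT hu)) (by positivity))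
  have htr : ∀ {u}, MemH1 (truncation D R) u →
      (eLpNorm (trace D R u) 2 (surfaceMeasure R)).toReal ≤ k * normR D τ R u := fun hu =>
    (ENNReal.toReal_mono (hN hu) le_add_self).trans (energySum_toReal_le hτ hu (hT hu))
  -- The factor `k` turns the energy into `normR`, and `Cp + 1` turns the energy into the full `H¹`
  -- size; each occurs once for `u` and once for `w`.
  refine ⟨((1 + τ + |ρ| * (R + 1)) * (Cp + 1) ^ 2 + τ) * k ^ 2, by positivity,
    fun u w hu hw => (abs_form_le hτ ρ hR hu hw (hT hu) (hT hw)).trans ?_⟩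
  have hnu : 0 ≤ normR D τ R u := Real.sqrt_nonneg _
  have hnw : 0 ≤ normR D τ R w := Real.sqrt_nonneg _
  calc _ ≤ (1 + τ + |ρ| * (R + 1)) * (((Cp + 1) * (k * normR D τ R u)) *
          ((Cp + 1) * (k * normR D τ R w))) +
        τ * ((k * normR D τ R u) * (k * normR D τ R w)) := by
        gcongr
        · exact hjet hu
        · exact hjet hw
        · exact htr hu
        · exact htr hw
    _ = _ := by ring
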